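/- \textbf{Lemma (NF-Yoneda).} Work in an arbitrary model of Quine's New Foundations (extensionality and comprehension for stratifiable formulas). Ordered pairs are Quine's type-level pairs, functions are sets of ordered pairs, and $\mathbf{N}$ is the category of sets and functions of the model, with terminal object $1=\{\emptyset\}$. ``Same size'' and $\cong$ between sets mean that some \emph{set of the model} is (the graph of) a bijection between them. For a set $A$ let $T(A)=\{\{x\} : x\in A\}$ and let $\mathbf{N}(1,A)$ be the set of functions $1\to A$. Let $\mathbf{C}$ be an internal category in $\mathbf{N}$, with sets of objects and arrows $C_0, C_1$, domain and codomain maps $d_0,d_1:C_1\to C_0$, identities $i:C_0\to C_1$ and composition $m:C_1\times_{C_0}C_1\to C_1$ (where $m\langle f,g\rangle$ is $f$ followed by $g$). Let $F=(F_0,\ \gamma_0:F_0\to C_0,\ e:F_0\times_{C_0}C_1\to F_0)$ be an internal diagram (discrete opfibration, internal covariant presheaf) on $\mathbf{C}$, that is, $\gamma_0(e\langle x,f\rangle)=d_1f$, $e\langle x,i(\gamma_0x)\rangle=x$ and $e\langle e\langle x,f\rangle,g\rangle=e\langle x,m\langle f,g\rangle\rangle$ whenever $\gamma_0x=d_0f$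 and $d_1f=d_0g$. Let $U\in C_0$, let $u:1\to C_0$ be the arrow picking $U$, and let $F(U)=\{x\in F_0:\gamma_0x=U\}$ be the pullback of $\gamma_0$ along $u$. Let $\mathbf{C}(U,-)=R(u)$ be given by the set $1\times_{C_0}C_1$ of all $\langle\emptyset,f\rangle$ with $d_0f=U$, the projection $\langle\emptyset,f\rangle\mapsto d_1f$ to $C_0$, and the action $\langle\langle\emptyset,f\rangle,g\rangle\mapsto\langle\emptyset,m\langle f,g\rangle\rangle$. A natural transformation between internal diagrams $(G_0,\gamma_0,e)$ and $(G_0',\gamma_0',e')$ is a function $\alpha:G_0\to G_0'$ with $\gamma_0'\alpha=\gamma_0$ and $\alpha(e\langle x,f\rangle)=e'\langle\alpha x,f\rangle$. Then $\mathbf{C}(U,-)$ is an internal diagram on $\mathbf{C}$, the natural transformations $\mathbf{C}(U,-)\to F$ form a set $\mathrm{Nat}(\mathbf{C}(U,-),F)$ of the model, so do the functions $1\to F(U)$, and $$\mathrm{Nat}(\mathbf{C}(U,-),F)\;\cong\;\mathbf{N}(1,F(U))\;\cong\;T(F(U)),$$ where the first bijection sends $\alpha$ to the function $1\to F(U)$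 with value $\alpha\langle\emptyset,i(U)\rangle$ and the second sends $p:1\to F(U)$ to $\{p(\emptyset)\}$. Consequently $\mathrm{Nat}(\mathbf{C}(U,-),F)$ has the same size as a set of singletons. Moreover, if $F(U)$ is cantorian, i.e. has the same size as $T(F(U))$, then $\mathrm{Nat}(\mathbf{C}(U,-),F)\cong F(U)$. -/

import Mathlib

namespace NF

/-! ### The language of set theory and stratification -/

/-- Formulas of the first-order language of set theory; variables are natural numbers. -/
inductive Fml : Type
  | mem (i j : ℕ) : Fml
  | eq (i j : ℕ) : Fml
  | neg (φ : Fml) : Fml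
  | and (φ ψ : Fml) : Fml
  | all (i : ℕ) (φ : Fml) : Fml

/-- Tarskian satisfaction of a formula under an assignment `s` of the variables. -/
def Fml.Sat {V : Type*} (E : V → V → Prop) : Fml → (ℕ → V) → Prop
  | .mem i j, s => E (s i) (s j)
  | .eq i j, s => s i = s j
  | .neg φ, s => ¬ φ.Sat E s
  | .and φ ψ, s => φ.Sat E s ∧ ψ.Sat E s
  | .all i φ, s => ∀ a : V, φ.Sat E (Function.update s i a)

/-- `σ` is a stratification of the formula: it gives the two sides of every subformula
`v_i = v_j` the same type, and in every subformula `v_i ∈ v_j` the type of `v_j` is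
one more than the type of `v_i`. -/
def Fml.StratBy (σ : ℕ → ℕ) : Fml → Prop
  | .mem i j => σ i + 1 = σ j
  | .eq i j => σ i = σ j
  | .neg φ => φ.StratBy σ
  | .and φ ψ => φ.StratBy σ ∧ ψ.StratBy σ
  | .all _ φ => φ.StratBy σ

/-- A formula is stratifiable if it has a stratification. -/
def Fml.Stratified (φ : Fml) : Prop := ∃ σ : ℕ → ℕ, φ.StratBy σ

/-- Models of Quine's New Foundations: extensionality and comprehension for stratifiable
formulas. In `comprehension`, the variable `0` is the bound variable of the set abstract and
the assignment `s` supplies all the parameters. -/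
class Model (V : Type*) where
  mem : V → V → Prop
  nonempty : Nonempty V
  extensionality : ∀ x y : V, (∀ z, mem z x ↔ mem z y) → x = y
  comprehension : ∀ φ : Fml, φ.Stratified → ∀ s : ℕ → V,
    ∃ y : V, ∀ z : V, mem z y ↔ φ.Sat mem (Function.update s 0 z)

infix:50 " ∈ₙ " => Model.mem

instance (V : Type*) [Model V] : Nonempty V := Model.nonempty

section Sets

variable {V : Type*} [Model V]

/-- The set abstract `{z | P z}`: the set of the model whose members are exactly the `z` with
`P z`. It is meaningful whenever there is such a set, in particular when `P` is given by a
stratifiable formula with parameters; otherwise it is arbitrary. -/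
noncomputable def setOf (P : V → Prop) : V :=
  Classical.epsilon (fun y : V => ∀ z, z ∈ₙ y ↔ P z)

/-- The empty set. -/
noncomputable def empty : V := setOf (fun _ => False)

/-- The singleton `{a}`. -/
noncomputable def sing (a : V) : V := setOf (fun z => z = a)

/-! ### Frege natural numbers -/

/-- The number zero, `{∅}`. -/
noncomputable def zero : V := sing empty

/-- The successor `{u ∪ {v} | u ∈ n, v ∉ u}` of `n`. -/
noncomputable def succ (n : V) : V :=
  setOf (fun w => ∃ u v : V, u ∈ₙ n ∧ ¬ v ∈ₙ u ∧ ∀ t, t ∈ₙ w ↔ (t ∈ₙ u ∨ t = v))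

/-- The set of natural numbers, the intersection of all inductive sets. -/
noncomputable def omega : V :=
  setOf (fun n => ∀ I : V, (zero ∈ₙ I ∧ ∀ k, k ∈ₙ I → succ k ∈ₙ I) → n ∈ₙ I)

/-! ### Quine's type-level ordered pairs -/

/-- `a` with every natural number in it replaced by its successor. -/
noncomputable def shift (a : V) : V :=
  setOf (fun m => (∃ n, n ∈ₙ a ∧ n ∈ₙ omega ∧ m = succ n) ∨ (m ∈ₙ a ∧ ¬ m ∈ₙ omega))

/-- The Quine ordered pair `{shift a | a ∈ x} ∪ {shift b ∪ {0} | b ∈ y}`. -/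
noncomputable def pair (x y : V) : V :=
  setOf (fun p => (∃ a, a ∈ₙ x ∧ p = shift a) ∨
    (∃ b, b ∈ₙ y ∧ ∀ t, t ∈ₙ p ↔ (t ∈ₙ shift b ∨ t = zero)))

/-! ### The category of sets of the model -/

/-- `f` is (the graph of) a function from `A` to `B`, i.e. an arrow `A → B` of the category of
sets of the model. -/
def IsFun (f A B : V) : Prop :=
  (∀ p, p ∈ₙ f → ∃ x y, x ∈ₙ A ∧ y ∈ₙ B ∧ p = pair x y) ∧
    ∀ x, x ∈ₙ A → ∃! y, pair x y ∈ₙ f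

/-- The value `f(x)`: the `y` with `⟨x, y⟩ ∈ f`. -/
noncomputable def ap (f x : V) : V := Classical.epsilon (fun y : V => pair x y ∈ₙ f)

/-- `f` is (the graph of) a bijection from `A` onto `B`. -/
def IsBij (f A B : V) : Prop :=
  IsFun f A B ∧ ∀ y, y ∈ₙ B → ∃! x, x ∈ₙ A ∧ pair x y ∈ₙ f

/-- `A` and `B` have the same size: some set of the model is a bijection between them. -/
def SameSize (A B : V) : Prop := ∃ f : V, IsBij f A B

/-- `A ⇒ B`, the set of all functions from `A` to `B`. -/
noncomputable def funSet (A B : V) : V := setOf (fun f => IsFun f A B)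

/-- The terminal object `1 = {∅}`. -/
noncomputable def one : V := sing empty

/-- The arrow `1 → A` that picks the element `a`, i.e. the graph `{⟨∅, a⟩}`. -/
noncomputable def point (a : V) : V := sing (pair empty a)

/-- The `T`-functor on objects: `T A = {{x} | x ∈ A}`. -/
noncomputable def T (A : V) : V := setOf (fun z => ∃ x, x ∈ₙ A ∧ z = sing x)

/-- `A` is cantorian: it has the same size as its set of singletons. -/
def Cantorian (A : V) : Prop := SameSize A (T A)

/-- The pullback `{⟨x, y⟩ | x ∈ A, y ∈ B, f(x) = g(y)}` of `f` (on `A`) and `g` (on `B`). -/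
noncomputable def fibProd (A B f g : V) : V :=
  setOf (fun p => ∃ x y c, x ∈ₙ A ∧ y ∈ₙ B ∧ pair x c ∈ₙ f ∧ pair y c ∈ₙ g ∧ p = pair x y)

end Sets

/-! ### Internal categories and internal diagrams -/

/-- An internal category in the category of sets of the model. The composite of `f` followed by
`g` is `m⟨f, g⟩`. Commutativity of the diagrams is expressed on elements. -/
structure InternalCategory (V : Type*) [Model V] where
  C₀ : V
  C₁ : V
  d₀ : V
  d₁ : V
  i : V
  m : V
  d₀_fun : IsFun d₀ C₁ C₀
  d₁_fun : IsFun d₁ C₁ C₀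
  i_fun : IsFun i C₀ C₁
  m_fun : IsFun m (fibProd C₁ C₁ d₁ d₀) C₁
  d₀_i : ∀ c, c ∈ₙ C₀ → ap d₀ (ap i c) = c
  d₁_i : ∀ c, c ∈ₙ C₀ → ap d₁ (ap i c) = c
  d₀_m : ∀ f g, f ∈ₙ C₁ → g ∈ₙ C₁ → ap d₁ f = ap d₀ g → ap d₀ (ap m (pair f g)) = ap d₀ f
  d₁_m : ∀ f g, f ∈ₙ C₁ → g ∈ₙ C₁ → ap d₁ f = ap d₀ g → ap d₁ (ap m (pair f g)) = ap d₁ g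
  id_m : ∀ f, f ∈ₙ C₁ → ap m (pair (ap i (ap d₀ f)) f) = f
  m_id : ∀ f, f ∈ₙ C₁ → ap m (pair f (ap i (ap d₁ f))) = f
  assoc : ∀ f g h, f ∈ₙ C₁ → g ∈ₙ C₁ → h ∈ₙ C₁ → ap d₁ f = ap d₀ g → ap d₁ g = ap d₀ h →
    ap m (pair (ap m (pair f g)) h) = ap m (pair f (ap m (pair g h)))

/-- The underlying data `(F₀, γ₀, e)` of an internal diagram. -/
structure DiagramData (V : Type*) where
  F₀ : V
  γ₀ : V
  e : V

section Diagrams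

variable {V : Type*} [Model V]

/-- `F` is an internal diagram (discrete opfibration, covariant internal presheaf) on `C`. -/
structure IsDiagram (C : InternalCategory V) (F : DiagramData V) : Prop where
  γ₀_fun : IsFun F.γ₀ F.F₀ C.C₀
  e_fun : IsFun F.e (fibProd F.F₀ C.C₁ F.γ₀ C.d₀) F.F₀
  γ₀_e : ∀ x f, x ∈ₙ F.F₀ → f ∈ₙ C.C₁ → ap F.γ₀ x = ap C.d₀ f →
    ap F.γ₀ (ap F.e (pair x f)) = ap C.d₁ f
  e_id : ∀ x, x ∈ₙ F.F₀ → ap F.e (pair x (ap C.i (ap F.γ₀ x))) = x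
  e_m : ∀ x f g, x ∈ₙ F.F₀ → f ∈ₙ C.C₁ → g ∈ₙ C.C₁ →
    ap F.γ₀ x = ap C.d₀ f → ap C.d₁ f = ap C.d₀ g →
    ap F.e (pair (ap F.e (pair x f)) g) = ap F.e (pair x (ap C.m (pair f g)))

/-- The diagram `R(γ)` on `C` freely generated by `γ : X → C₀`: its total object is
`X ×_{C₀} C₁`, lying over `C₀` through `⟨x, f⟩ ↦ d₁ f`, and the arrows of `C` act by
`⟨⟨x, f⟩, g⟩ ↦ ⟨x, m⟨f, g⟩⟩`. -/
noncomputable def R (C : InternalCategory V) (X γ : V) : DiagramData V where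
  F₀ := fibProd X C.C₁ γ C.d₀
  γ₀ := setOf (fun q => ∃ x f c, pair x f ∈ₙ fibProd X C.C₁ γ C.d₀ ∧ pair f c ∈ₙ C.d₁ ∧
    q = pair (pair x f) c)
  e := setOf (fun q => ∃ x f g h, pair x f ∈ₙ fibProd X C.C₁ γ C.d₀ ∧
    pair (pair f g) h ∈ₙ C.m ∧ q = pair (pair (pair x f) g) (pair x h))

/-- The covariant representable `C(U, -) = R(u)`, where `u : 1 → C₀` picks `U`. -/
noncomputable def representable (C : InternalCategory V) (U : V) : DiagramData V :=
  R C one (point U)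

/-- `F(U)`, the fibre of `γ₀ : F₀ → C₀` over `U` (the pullback of `γ₀` along `u : 1 → C₀`). -/
noncomputable def DiagramData.fibre (F : DiagramData V) (U : V) : V :=
  setOf (fun x => x ∈ₙ F.F₀ ∧ pair x U ∈ₙ F.γ₀)

/-- `α` is a natural transformation `F → G` of internal diagrams on `C`: an arrow `F₀ → G₀`
over `C₀` which commutes with the actions of `C`. -/
def IsNat (C : InternalCategory V) (F G : DiagramData V) (α : V) : Prop :=
  IsFun α F.F₀ G.F₀ ∧
  (∀ x, x ∈ₙ F.F₀ → ap G.γ₀ (ap α x) = ap F.γ₀ x) ∧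
  ∀ x f, x ∈ₙ F.F₀ → f ∈ₙ C.C₁ → ap F.γ₀ x = ap C.d₀ f →
    ap α (ap F.e (pair x f)) = ap G.e (pair (ap α x) f)

/-- `Nat(F, G)`, the set of all natural transformations `F → G`. -/
noncomputable def natSet (C : InternalCategory V) (F G : DiagramData V) : V :=
  setOf (fun α => IsNat C F G α)

end Diagrams

/-! ### The set abstracts above have the intended members -/

section Membership

variable {V : Type*} [Model V]

def Fml.or (φ ψ : Fml) : Fml := .neg (.and (.neg φ) (.neg ψ))
def Fml.imp (φ ψ : Fml) : Fml := .neg (.and φ (.neg ψ))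
def Fml.iff (φ ψ : Fml) : Fml := .and (.imp φ ψ) (.imp ψ φ)
def Fml.ex (i : ℕ) (φ : Fml) : Fml := .neg (.all i (.neg φ))

set_option linter.unusedSectionVars false
set_option linter.unusedSimpArgs false

section
variable (E : V → V → Prop) (s : ℕ → V) (φ ψ : Fml) (i j : ℕ) (σ : ℕ → ℕ)

theorem sat_mem : (Fml.mem i j).Sat E s ↔ E (s i) (s j) := Iff.rfl
theorem sat_eq : (Fml.eq i j).Sat E s ↔ s i = s j := Iff.rfl
theorem sat_neg : (Fml.neg φ).Sat E s ↔ ¬ φ.Sat E s := Iff.rfl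
theorem sat_and : (Fml.and φ ψ).Sat E s ↔ φ.Sat E s ∧ ψ.Sat E s := Iff.rfl
theorem sat_all : (Fml.all i φ).Sat E s ↔ ∀ a, φ.Sat E (Function.update s i a) := Iff.rfl
theorem sat_or : (Fml.or φ ψ).Sat E s ↔ φ.Sat E s ∨ ψ.Sat E s := by
  simp only [Fml.or, sat_neg, sat_and]; tauto
theorem sat_imp : (Fml.imp φ ψ).Sat E s ↔ (φ.Sat E s → ψ.Sat E s) := by
  simp only [Fml.imp, sat_neg, sat_and]; tauto
theorem sat_iff : (Fml.iff φ ψ).Sat E s ↔ (φ.Sat E s ↔ ψ.Sat E s) := by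
  simp only [Fml.iff, sat_imp, sat_and]; tauto
theorem sat_ex : (Fml.ex i φ).Sat E s ↔ ∃ a, φ.Sat E (Function.update s i a) := by
  simp only [Fml.ex, sat_neg, sat_all]; push Not; rfl
end

theorem mem_setOf_of_exists {P : V → Prop} (h : ∃ y : V, ∀ z, z ∈ₙ y ↔ P z) (z : V) :
    z ∈ₙ setOf P ↔ P z := Classical.epsilon_spec h z

/-- Comprehension for a set abstract given by a stratified formula. -/
theorem mem_setOf_of_fml {P : V → Prop} (φ : Fml) (hφ : φ.Stratified) (s : ℕ → V)
    (h : ∀ z, φ.Sat Model.mem (Function.update s 0 z) ↔ P z) (z : V) :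
    z ∈ₙ setOf P ↔ P z := by
  obtain ⟨y, hy⟩ := Model.comprehension φ hφ s
  exact mem_setOf_of_exists ⟨y, fun z => (hy z).trans (h z)⟩ z

theorem ext_iff {x y : V} : x = y ↔ ∀ z, z ∈ₙ x ↔ z ∈ₙ y :=
  ⟨fun h _ => h ▸ Iff.rfl, Model.extensionality x y⟩

theorem mem_empty (z : V) : z ∈ₙ (empty : V) ↔ False :=
  mem_setOf_of_fml (.neg (.eq 0 0)) ⟨fun _ => 0, rfl⟩ (fun _ => Classical.arbitrary V)
    (fun z => by simp [Fml.Sat]) z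

theorem mem_sing (a z : V) : z ∈ₙ sing a ↔ z = a :=
  mem_setOf_of_fml (.eq 0 1) ⟨fun _ => 0, rfl⟩ (fun _ => a)
    (fun z => by simp [Fml.Sat]) z

/-- Types of the auxiliary variables: `10`, `11` have type 0, `12`, `13` type 1, and so on. -/
def tp (k : ℕ) : ℕ := (k - 10) / 2

/-- The formula `v_w = v_u ∪ {v_v}`. -/
def fAdj (w u v : ℕ) : Fml := .all 10 (.iff (.mem 10 w) (.or (.mem 10 u) (.eq 10 v)))

/-- The body of the definition of the successor. -/
def fSuccBody (w n : ℕ) : Fml :=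
  .ex 12 (.ex 11 (.and (.mem 12 n) (.and (.neg (.mem 11 12)) (fAdj w 12 11))))

/-- The formula `v_m = v_n + 1`. -/
def fSucc (m n : ℕ) : Fml := .all 13 (.iff (.mem 13 m) (fSuccBody 13 n))

theorem mem_succ (n w : V) : w ∈ₙ succ n ↔
    ∃ u v : V, u ∈ₙ n ∧ ¬ v ∈ₙ u ∧ ∀ t, t ∈ₙ w ↔ (t ∈ₙ u ∨ t = v) :=
  mem_setOf_of_fml (fSuccBody 0 1)
    ⟨fun k => if k = 0 then 1 else if k = 1 then 2 else tp k, by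
      simp [fSuccBody, fAdj, Fml.StratBy, Fml.ex, Fml.or, Fml.iff, Fml.imp, tp]⟩
    (fun _ => n)
    (fun z => by
      simp [fSuccBody, fAdj, sat_mem, sat_eq, sat_neg, sat_and, sat_all, sat_or, sat_iff,
        sat_ex, Function.update_apply]) w

theorem sat_fSucc (m n : ℕ) (hm : 20 ≤ m ∨ m < 10) (hn : 20 ≤ n ∨ n < 10) (s : ℕ → V) :
    (fSucc m n).Sat Model.mem s ↔ s m = succ (s n) := by
  have h1 : m ≠ 10 ∧ m ≠ 11 ∧ m ≠ 12 ∧ m ≠ 13 := by omega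
  have h2 : n ≠ 10 ∧ n ≠ 11 ∧ n ≠ 12 ∧ n ≠ 13 := by omega
  simp [ext_iff (x := s m), mem_succ, fSucc, fSuccBody, fAdj, sat_mem, sat_eq, sat_neg, sat_and,
    sat_all, sat_or, sat_iff, sat_ex, Function.update_apply, h1, h2]

theorem mem_omega (n : V) : n ∈ₙ (omega : V) ↔
    ∀ I : V, (zero ∈ₙ I ∧ ∀ k, k ∈ₙ I → succ k ∈ₙ I) → n ∈ₙ I := by
  refine mem_setOf_of_fml (.all 1 (.imp (.and (.mem 2 1)
      (.all 3 (.all 4 (.imp (.and (.mem 3 1) (fSucc 4 3)) (.mem 4 1))))) (.mem 0 1)))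
    ⟨fun k => if k = 1 then 3 else if k < 10 then 2 else tp k, ?_⟩ (fun _ => zero) ?_ n
  · simp [fSucc, fSuccBody, fAdj, Fml.StratBy, Fml.ex, Fml.or, Fml.iff, Fml.imp, tp]
  · intro z
    simp [sat_fSucc, sat_mem, sat_and, sat_all, sat_imp, Function.update_apply]

/-- The body of the definition of `shift`; variable `30` stands for the set of naturals. -/
def fShiftBody (m a : ℕ) : Fml :=
  .or (.ex 20 (.and (.mem 20 a) (.and (.mem 20 30) (fSucc m 20))))
    (.and (.mem m a) (.neg (.mem m 30)))

theorem mem_shift (a m : V) : m ∈ₙ shift a ↔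
    (∃ n, n ∈ₙ a ∧ n ∈ₙ omega ∧ m = succ n) ∨ (m ∈ₙ a ∧ ¬ m ∈ₙ omega) := by
  refine mem_setOf_of_fml (fShiftBody 0 1)
    ⟨fun k => if k = 1 ∨ k = 30 then 3 else if k < 10 ∨ k = 20 then 2 else tp k, ?_⟩
    (fun k => if k = 1 then a else omega) ?_ m
  · simp [fShiftBody, fSucc, fSuccBody, fAdj, Fml.StratBy, Fml.ex, Fml.or, Fml.iff, Fml.imp, tp]
  · intro z
    simp [fShiftBody, sat_fSucc, sat_mem, sat_and, sat_or, sat_neg, sat_ex,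
      Function.update_apply]

/-- The body of the definition of `pair`; variable `31` stands for the number zero. -/
def fPairBody (p x y : ℕ) : Fml :=
  .or (.ex 22 (.and (.mem 22 x) (.all 21 (.iff (.mem 21 p) (fShiftBody 21 22)))))
    (.ex 22 (.and (.mem 22 y)
      (.all 21 (.iff (.mem 21 p) (.or (fShiftBody 21 22) (.eq 21 31))))))

/-- The formula `v_q = ⟨v_x, v_y⟩`. -/
def fPair (q x y : ℕ) : Fml := .all 23 (.iff (.mem 23 q) (fPairBody 23 x y))

/-- Types for formulas with pairs: the variables below `10` stand for pairs and their components
and have type 4, the variables from `40` on stand for sets of these and have type 5; the others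
are auxiliary. -/
def tpPair (k : ℕ) : ℕ :=
  if k < 10 then 4 else if k < 20 then tp k else if k < 22 then 2 else if k < 31 then 3
  else if k = 31 then 2 else 5

theorem sat_fShiftBody (m a : ℕ) (hm : 21 ≤ m ∨ m < 10) (ha : 21 ≤ a ∨ a < 10) (s : ℕ → V)
    (h30 : s 30 = omega) : (fShiftBody m a).Sat Model.mem s ↔ s m ∈ₙ shift (s a) := by
  have h1 : m ≠ 20 := by omega
  have h2 : a ≠ 20 := by omega
  have h3 : 20 ≤ m ∨ m < 10 := by omega
  simp [fShiftBody, mem_shift, sat_fSucc, sat_mem, sat_and, sat_or, sat_neg, sat_ex,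
    Function.update_apply, h1, h2, h3, h30]

theorem mem_pair (x y p : V) : p ∈ₙ pair x y ↔ (∃ a, a ∈ₙ x ∧ p = shift a) ∨
    (∃ b, b ∈ₙ y ∧ ∀ t, t ∈ₙ p ↔ (t ∈ₙ shift b ∨ t = zero)) := by
  refine mem_setOf_of_fml (fPairBody 0 1 2)
    ⟨fun k => if k = 0 then 3 else tpPair k, ?_⟩
    (fun k => if k = 1 then x else if k = 2 then y else if k = 30 then omega else zero) ?_ p
  · simp [fPairBody, fShiftBody, fSucc, fSuccBody, fAdj, Fml.StratBy, Fml.ex, Fml.or, Fml.iff,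
      Fml.imp, tp, tpPair]
  · intro z
    simp [fPairBody, sat_fShiftBody, sat_mem, sat_eq, sat_and, sat_or, sat_iff, sat_ex, sat_all,
      Function.update_apply, ext_iff (x := z)]

theorem sat_fPair (q x y : ℕ) (hq : 40 ≤ q ∨ q < 10) (hx : 40 ≤ x ∨ x < 10)
    (hy : 40 ≤ y ∨ y < 10) (s : ℕ → V) (h30 : s 30 = omega) (h31 : s 31 = zero) :
    (fPair q x y).Sat Model.mem s ↔ s q = pair (s x) (s y) := by
  have h1 : q ≠ 21 ∧ q ≠ 22 ∧ q ≠ 23 := by omega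
  have h2 : x ≠ 21 ∧ x ≠ 22 ∧ x ≠ 23 := by omega
  have h3 : y ≠ 21 ∧ y ≠ 22 ∧ y ≠ 23 := by omega
  rw [ext_iff (x := s q)]
  simp [fPair, fPairBody, mem_pair, sat_fShiftBody, sat_mem, sat_eq, sat_and, sat_or, sat_iff,
    sat_ex, sat_all, Function.update_apply, h1, h2, h3, h30, h31]
  simp only [ext_iff (y := shift _)]

theorem mem_T (A z : V) : z ∈ₙ T A ↔ ∃ x, x ∈ₙ A ∧ z = sing x :=
  mem_setOf_of_fml (.ex 1 (.and (.mem 1 2) (.all 3 (.iff (.mem 3 0) (.eq 3 1)))))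
    ⟨fun k => if k = 0 ∨ k = 2 then 1 else 0, by
      simp [Fml.StratBy, Fml.ex, Fml.iff, Fml.imp]⟩
    (fun _ => A)
    (fun z => by
      simp [sat_mem, sat_eq, sat_and, sat_iff, sat_ex, sat_all, Function.update_apply,
        ext_iff (x := z), mem_sing]) z

theorem mem_fibProd (A B f g p : V) : p ∈ₙ fibProd A B f g ↔
    ∃ x y c, x ∈ₙ A ∧ y ∈ₙ B ∧ pair x c ∈ₙ f ∧ pair y c ∈ₙ g ∧ p = pair x y := by
  refine mem_setOf_of_fml (.ex 1 (.ex 2 (.ex 3 (.and (.mem 1 40) (.and (.mem 2 41)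
      (.and (.ex 4 (.and (fPair 4 1 3) (.mem 4 42))) (.and (.ex 4 (.and (fPair 4 2 3) (.mem 4 43)))
        (fPair 0 1 2))))))))
    ⟨tpPair, ?_⟩
    (fun k => if k = 40 then A else if k = 41 then B else if k = 42 then f else
      if k = 43 then g else if k = 30 then omega else zero) ?_ p
  · simp [fPair, fPairBody, fShiftBody, fSucc, fSuccBody, fAdj, Fml.StratBy, Fml.ex, Fml.or,
      Fml.iff, Fml.imp, tp, tpPair]
  · intro z
    simp [sat_fPair, sat_mem, sat_and, sat_ex, Function.update_apply]

theorem mem_fibre (F : DiagramData V) (U x : V) :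
    x ∈ₙ F.fibre U ↔ x ∈ₙ F.F₀ ∧ pair x U ∈ₙ F.γ₀ := by
  refine mem_setOf_of_fml (.and (.mem 0 40) (.ex 4 (.and (fPair 4 0 1) (.mem 4 41))))
    ⟨tpPair, ?_⟩
    (fun k => if k = 40 then F.F₀ else if k = 41 then F.γ₀ else if k = 1 then U else
      if k = 30 then omega else zero) ?_ x
  · simp [fPair, fPairBody, fShiftBody, fSucc, fSuccBody, fAdj, Fml.StratBy, Fml.ex, Fml.or,
      Fml.iff, Fml.imp, tp, tpPair]
  · intro z
    simp [sat_fPair, sat_mem, sat_and, sat_ex, Function.update_apply]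

end Membership

end NF

namespace NF

/-! ### Definability by stratified formulas, with de Bruijn indices -/

/-! The bijection is the usual Yoneda one. A natural transformation `α` is determined by its value
at the identity of `U`, because `α⟨∅, f⟩ = e⟨α⟨∅, i(U)⟩, f⟩` (`IsNat.ap_eq`), and every `x` in
`F(U)` is such a value, namely for `⟨∅, f⟩ ↦ e⟨x, f⟩` (`exists_isNat`). What NF changes is the
bookkeeping of types. A Quine pair has the type of its components, so `α` lies one type above its
values and the evident graph of `α ↦ α⟨∅, i(U)⟩` is not stratified. Replacing the value `x` by the
function `{⟨∅, x⟩}`, or by `{x}`, restores the type; hence `N(1, F(U))` and `T(F(U))` appear where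
`F(U)` would be expected.

Every set that is used has to come from a stratified formula. `Definable` is a calculus for this: it
is closed under connectives and quantifiers, and the only obligations are equations between types.

Most of the work goes into the injectivity of Quine's pairs (`pair_inj`). It needs `succ` to be
injective on `omega`, hence the axiom of infinity, which in NF is a theorem of Specker
(`not_forall_fin`). Pairs are not available at that stage, so finite sets are compared through Frege
numbers: they are equinumerous when they belong to a common number.

Suppose that every set is finite, and write `V` for the universe. Let `S` be the least set of
cardinals that contains `|T V|` and, with `|P(a)|`, contains `|T a|`, a logarithm to base two. The
operation `T` on cardinals maps `S` into `S`, and every member of `S` except `|T V|` is `T` of a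
member. The cardinal `|T V|` is not, since `|V|` is not in `S`. So `S` is `T[S]` plus one element.
But `T[S]` is equinumerous with the set of singletons of elements of `S`, which has the same parity
as `S`: a contradiction. -/

/-- The environment `a, s 0, s 1, …`. -/
def push {α : Type*} (a : α) (s : ℕ → α) : ℕ → α
  | 0 => a
  | n + 1 => s n

local infixr:67 " ∷ " => push

section Definability

/-- The type of a variable, where variable `0` gets type `t₀` and variable `⟨b, t⟩ + 1` type `t`. -/
def varType (t₀ : ℕ) : ℕ → ℕ
  | 0 => t₀
  | k + 1 => (Nat.unpair k).2

/-- The name of the bound variable of type `t` at depth `L`. -/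
def boundVar (L t : ℕ) : ℕ := Nat.pair (2 * L + 1) t + 1

variable {V : Type*} [Model V]

/-- The predicate `P` of an environment is given by a stratified formula in which the `i`-th
entry of the environment has type `Γ i`. -/
def Definable (Γ : ℕ → ℕ) (P : (ℕ → V) → Prop) : Prop :=
  ∀ (t₀ L : ℕ) (ν : ℕ → ℕ), (∀ i, varType t₀ (ν i) = Γ i) →
    (∀ i L' t, L ≤ L' → ν i ≠ boundVar L' t) →
    ∃ φ : Fml, φ.StratBy (varType t₀) ∧ ∀ s, φ.Sat Model.mem s ↔ P (fun i => s (ν i))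

namespace Definable

variable {Γ : ℕ → ℕ} {P Q : (ℕ → V) → Prop}

theorem congr (h : ∀ s, P s ↔ Q s) (hP : Definable Γ P) : Definable Γ Q :=
  (funext fun s => propext (h s) : P = Q) ▸ hP

theorem mem (i j : ℕ) (h : Γ i + 1 = Γ j) : Definable Γ (fun s : ℕ → V => s i ∈ₙ s j) :=
  fun _ _ ν hν _ => ⟨.mem (ν i) (ν j), by simp only [Fml.StratBy, hν, h], fun _ => Iff.rfl⟩

theorem eq (i j : ℕ) (h : Γ i = Γ j) : Definable Γ (fun s : ℕ → V => s i = s j) :=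
  fun _ _ ν hν _ => ⟨.eq (ν i) (ν j), by simp only [Fml.StratBy, hν, h], fun _ => Iff.rfl⟩

theorem not (hP : Definable Γ P) : Definable Γ (fun s => ¬ P s) := fun t₀ L ν hν hL => by
  obtain ⟨φ, hφ, h⟩ := hP t₀ L ν hν hL
  exact ⟨.neg φ, hφ, fun s => not_congr (h s)⟩

theorem and (hP : Definable Γ P) (hQ : Definable Γ Q) : Definable Γ (fun s => P s ∧ Q s) :=
  fun t₀ L ν hν hL => by
    obtain ⟨φ, hφ, h⟩ := hP t₀ L ν hν hL
    obtain ⟨ψ, hψ, h'⟩ := hQ t₀ L ν hν hL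
    exact ⟨.and φ ψ, ⟨hφ, hψ⟩, fun s => and_congr (h s) (h' s)⟩

theorem or (hP : Definable Γ P) (hQ : Definable Γ Q) : Definable Γ (fun s => P s ∨ Q s) :=
  congr (fun _ => by tauto) (hP.not.and hQ.not).not

theorem imp (hP : Definable Γ P) (hQ : Definable Γ Q) : Definable Γ (fun s => P s → Q s) :=
  congr (fun _ => by tauto) (hP.and hQ.not).not

theorem iff (hP : Definable Γ P) (hQ : Definable Γ Q) : Definable Γ (fun s => P s ↔ Q s) :=
  congr (fun _ => by tauto) ((hP.imp hQ).and (hQ.imp hP))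

/-- The name of the bound variable encodes its type `t` and the depth `L`. The body is treated at
depth `L + 1`, so binders further inside choose other names and nothing is captured. -/
theorem all (t : ℕ) {P : (ℕ → V) → V → Prop}
    (hP : Definable (push t Γ) (fun s => P (fun n => s (n + 1)) (s 0))) :
    Definable Γ (fun s => ∀ a, P s a) := fun t₀ L ν hν hL => by
  obtain ⟨φ, hφ, h⟩ := hP t₀ (L + 1) (push (boundVar L t) ν)
    (by rintro (_ | i)
        · simp [push, boundVar, varType]
        · exact hν i)
    (by rintro (_ | i) L' t' hL'
        · simp only [push, boundVar, ne_eq, add_left_inj, Nat.pair_eq_pair]; omega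
        · exact hL i L' t' (by omega))
  refine ⟨.all (boundVar L t) φ, hφ, fun s => forall_congr' fun a => ?_⟩
  have h1 : (fun n => Function.update s (boundVar L t) a (push (boundVar L t) ν (n + 1))) =
      fun i => s (ν i) :=
    funext fun i => Function.update_of_ne (hL i L t le_rfl) _ _
  have h2 : Function.update s (boundVar L t) a (push (boundVar L t) ν 0) = a :=
    Function.update_self ..
  refine (h _).trans (iff_of_eq ?_)
  dsimp only
  rw [h1, h2]

theorem ex (t : ℕ) {P : (ℕ → V) → V → Prop}
    (hP : Definable (push t Γ) (fun s => P (fun n => s (n + 1)) (s 0))) :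
    Definable Γ (fun s => ∃ a, P s a) :=
  congr (fun _ => by simp) (all t (P := fun s a => ¬ P s a) hP.not).not

/-- Allows a given definable relation to be used as a subformula under further quantifiers, where
its arguments sit at other positions. -/
theorem rename {Γ' : ℕ → ℕ} (hP : Definable Γ P) (f : ℕ → ℕ) (hf : ∀ i, Γ' (f i) = Γ i) :
    Definable Γ' (fun s => P (fun i => s (f i))) := fun t₀ L ν hν hL =>
  hP t₀ L (fun i => ν (f i)) (fun i => (hν _).trans (hf i)) (fun i => hL (f i))

/-- Comprehension. -/
theorem exists_set (hP : Definable Γ P) (s : ℕ → V) :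
    ∃ y : V, ∀ z, z ∈ₙ y ↔ P (push z s) := by
  -- Variable `0` is the one abstracted by comprehension. Parameter names use even first components,
  -- bound variables odd ones, so the two never clash; the parameter index is recovered by decoding
  -- and halving.
  obtain ⟨φ, hφ, h⟩ := hP (Γ 0) 0
    (fun i => i.casesOn 0 (fun i => Nat.pair (2 * i) (Γ (i + 1)) + 1))
    (by rintro (_ | i) <;> simp [varType])
    (by rintro (_ | i) L' t _
        · simp [boundVar]
        · simp only [boundVar, ne_eq, add_left_inj, Nat.pair_eq_pair]; omega)
  obtain ⟨y, hy⟩ := Model.comprehension φ ⟨_, hφ⟩ (fun k => s ((Nat.unpair (k - 1)).1 / 2))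
  refine ⟨y, fun z => (hy z).trans ((h _).trans (iff_of_eq (congrArg P ?_)))⟩
  funext i
  cases i <;> simp [push]

end Definable

/-- The environment is padded with the last parameter. Where no parameter is needed a dummy one is
supplied. A fixed set may be passed as a parameter so that it can take whatever type the formula
requires. -/
theorem exists_set₁ (P : V → V → Prop) (t : ℕ → ℕ) (h : Definable t (fun s => P (s 0) (s 1)))
    (a : V) : ∃ y : V, ∀ z, z ∈ₙ y ↔ P z a :=
  h.exists_set (fun _ => a)

theorem exists_set₂ (P : V → V → V → Prop) (t : ℕ → ℕ)
    (h : Definable t (fun s => P (s 0) (s 1) (s 2)))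
    (a b : V) : ∃ y : V, ∀ z, z ∈ₙ y ↔ P z a b :=
  h.exists_set (push a fun _ => b)

theorem exists_set₃ (P : V → V → V → V → Prop) (t : ℕ → ℕ)
    (h : Definable t (fun s => P (s 0) (s 1) (s 2) (s 3)))
    (a b c : V) : ∃ y : V, ∀ z, z ∈ₙ y ↔ P z a b c :=
  h.exists_set (push a (push b fun _ => c))

end Definability

/-! ### Elementary operations on sets -/

section Operations

variable {V : Type*} [Model V]

/-- `{z | z ∈ x ∨ z = v}` -/
noncomputable def adj (x v : V) : V := setOf (fun z => z ∈ₙ x ∨ z = v)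

/-- `{z ∈ x | z ≠ v}` -/
noncomputable def del (x v : V) : V := setOf (fun z => z ∈ₙ x ∧ z ≠ v)

noncomputable def union (x y : V) : V := setOf (fun z => z ∈ₙ x ∨ z ∈ₙ y)

noncomputable def univ : V := setOf (fun _ => True)

def Sub (x y : V) : Prop := ∀ z, z ∈ₙ x → z ∈ₙ y

noncomputable def pow (x : V) : V := setOf (fun z => Sub z x)

@[ext] theorem set_ext {x y : V} (h : ∀ z, z ∈ₙ x ↔ z ∈ₙ y) : x = y := ext_iff.2 h

theorem mem_adj {x v z : V} : z ∈ₙ adj x v ↔ z ∈ₙ x ∨ z = v :=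
  mem_setOf_of_exists (exists_set₂ (fun z x v => z ∈ₙ x ∨ z = v) (0 ∷ 1 ∷ 0 ∷ 0)
    ((Definable.mem 0 1 rfl).or (.eq 0 2 rfl)) x v) z

theorem mem_del {x v z : V} : z ∈ₙ del x v ↔ z ∈ₙ x ∧ z ≠ v :=
  mem_setOf_of_exists (exists_set₂ (fun z x v => z ∈ₙ x ∧ z ≠ v) (0 ∷ 1 ∷ 0 ∷ 0)
    ((Definable.mem 0 1 rfl).and (Definable.eq 0 2 rfl).not) x v) z

theorem mem_union {x y z : V} : z ∈ₙ union x y ↔ z ∈ₙ x ∨ z ∈ₙ y :=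
  mem_setOf_of_exists (exists_set₂ (fun z x y => z ∈ₙ x ∨ z ∈ₙ y) (0 ∷ 1 ∷ 1 ∷ 0)
    ((Definable.mem 0 1 rfl).or (.mem 0 2 rfl)) x y) z

theorem mem_univ (z : V) : z ∈ₙ (univ : V) := by
  refine (mem_setOf_of_exists ?_ z).2 trivial
  exact (Definable.congr (Q := fun _ => True) (fun _ => by simp)
    (Definable.eq (Γ := fun _ => 0) 0 0 rfl)).exists_set (fun _ => z)

theorem Definable.sub {Γ : ℕ → ℕ} {t : ℕ} (i j : ℕ) (hi : Γ i = t + 1) (hj : Γ j = t + 1) :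
    Definable Γ (fun s : ℕ → V => Sub (s i) (s j)) :=
  .all t (.imp (.mem 0 (i + 1) hi.symm) (.mem 0 (j + 1) hj.symm))

theorem mem_pow {x z : V} : z ∈ₙ pow x ↔ Sub z x :=
  mem_setOf_of_exists (exists_set₁ Sub (1 ∷ 1 ∷ 0) (.sub 0 1 rfl rfl) x) z

/-- The formal language has no terms, so an operation is definable through its graph. Nested terms
are later unfolded by naming each intermediate value with an existential quantifier. -/
theorem Definable.eq_adj {Γ : ℕ → ℕ} {t : ℕ} (i j k : ℕ) (hi : Γ i = t + 1) (hj : Γ j = t + 1)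
    (hk : Γ k = t) : Definable Γ (fun s : ℕ → V => s i = adj (s j) (s k)) :=
  .congr (fun s => by rw [ext_iff]; simp only [mem_adj]) <|
    .all t (P := fun s z => z ∈ₙ s i ↔ (z ∈ₙ s j ∨ z = s k))
      (.iff (.mem 0 (i + 1) hi.symm) (.or (.mem 0 (j + 1) hj.symm) (.eq 0 (k + 1) hk.symm)))

theorem Definable.eq_sing {Γ : ℕ → ℕ} {t : ℕ} (i j : ℕ) (hi : Γ i = t + 1) (hj : Γ j = t) :
    Definable Γ (fun s : ℕ → V => s i = sing (s j)) :=
  .congr (fun s => by rw [ext_iff]; simp only [mem_sing]) <|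
    .all t (P := fun s z => z ∈ₙ s i ↔ z = s j)
      (.iff (.mem 0 (i + 1) hi.symm) (.eq 0 (j + 1) hj.symm))

theorem Definable.eq_empty {Γ : ℕ → ℕ} {t : ℕ} (i : ℕ) (hi : Γ i = t + 1) :
    Definable Γ (fun s : ℕ → V => s i = empty) :=
  .congr (fun s => by rw [ext_iff]; simp only [mem_empty, iff_false]) <|
    .all t (P := fun s z => ¬ z ∈ₙ s i) (.not (.mem 0 (i + 1) hi.symm))

theorem Definable.eq_pow {Γ : ℕ → ℕ} {t : ℕ} (i j : ℕ) (hi : Γ i = t + 2) (hj : Γ j = t + 1) :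
    Definable Γ (fun s : ℕ → V => s i = pow (s j)) :=
  .congr (fun s => by rw [ext_iff]; simp only [mem_pow]) <|
    .all (t + 1) (P := fun s z => z ∈ₙ s i ↔ Sub z (s j))
      (.iff (.mem 0 (i + 1) hi.symm) (.sub 0 (j + 1) rfl hj))

theorem Definable.eq_T {Γ : ℕ → ℕ} {t : ℕ} (i j : ℕ) (hi : Γ i = t + 2) (hj : Γ j = t + 1) :
    Definable Γ (fun s : ℕ → V => s i = T (s j)) :=
  .congr (fun s => by rw [ext_iff]; simp only [mem_T]) <|
    .all (t + 1) (P := fun s z => z ∈ₙ s i ↔ ∃ x, x ∈ₙ s j ∧ z = sing x)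
      (.iff (.mem 0 (i + 1) hi.symm)
        (.ex t (.and (.mem 0 (j + 2) hj.symm) (.eq_sing 1 0 rfl rfl))))

theorem sing_injective {x y : V} (h : sing x = sing y) : x = y :=
  (mem_sing y x).1 (h ▸ (mem_sing x x).2 rfl)

theorem sing_mem_T {x A : V} : sing x ∈ₙ T A ↔ x ∈ₙ A := by
  rw [mem_T]
  exact ⟨fun ⟨y, hy, h⟩ => sing_injective h ▸ hy, fun h => ⟨x, h, rfl⟩⟩

theorem exists_mem_of_ne_empty {x : V} (h : x ≠ empty) : ∃ v, v ∈ₙ x := by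
  by_contra! hx
  exact h (set_ext fun z => by simp [mem_empty, hx])

theorem Sub.refl (x : V) : Sub x x := fun _ h => h

theorem Sub.antisymm {x y : V} (h : Sub x y) (h' : Sub y x) : x = y :=
  set_ext fun z => ⟨h z, h' z⟩

theorem adj_del {x v : V} (h : v ∈ₙ x) : adj (del x v) v = x := by
  ext z; rw [mem_adj, mem_del]; by_cases hz : z = v <;> simp [hz, h]

theorem del_adj {x v : V} (h : ¬ v ∈ₙ x) : del (adj x v) v = x := by
  ext z; rw [mem_del, mem_adj]; by_cases hz : z = v <;> simp [hz, h]

theorem not_mem_del (x v : V) : ¬ v ∈ₙ del x v := fun h => (mem_del.1 h).2 rfl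

theorem adj_of_mem {x v : V} (h : v ∈ₙ x) : adj x v = x := by
  ext z; rw [mem_adj]; exact ⟨fun hz => hz.elim id fun e => e ▸ h, Or.inl⟩

end Operations

/-! ### Frege natural numbers and equinumerosity of finite sets -/

section Frege

variable {V : Type*} [Model V]

theorem mem_zero {x : V} : x ∈ₙ (zero : V) ↔ x = empty := mem_sing _ _

theorem mem_succ_iff {n w : V} : w ∈ₙ succ n ↔ ∃ u v, u ∈ₙ n ∧ ¬ v ∈ₙ u ∧ w = adj u v := by
  simp only [mem_succ, ext_iff (x := w), mem_adj]

theorem adj_mem_succ {n u v : V} (hu : u ∈ₙ n) (hv : ¬ v ∈ₙ u) : adj u v ∈ₙ succ n :=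
  mem_succ_iff.2 ⟨u, v, hu, hv, rfl⟩

theorem mem_adj_self (u v : V) : v ∈ₙ adj u v := mem_adj.2 (.inr rfl)

theorem empty_not_mem_succ (n : V) : ¬ empty ∈ₙ succ n := fun h => by
  obtain ⟨u, v, _, _, h⟩ := mem_succ_iff.1 h
  exact (mem_empty v).1 (h ▸ mem_adj_self u v)

theorem zero_ne_succ (n : V) : zero ≠ succ n := fun h =>
  empty_not_mem_succ n (h ▸ mem_zero.2 rfl)

theorem zero_mem_omega : zero ∈ₙ (omega : V) := (mem_omega _).2 fun _ h => h.1

theorem succ_mem_omega {n : V} (h : n ∈ₙ omega) : succ n ∈ₙ omega :=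
  (mem_omega _).2 fun I hI => hI.2 _ ((mem_omega _).1 h I hI)

theorem Definable.eq_succ {Γ : ℕ → ℕ} {t : ℕ} (i j : ℕ) (hi : Γ i = t + 2) (hj : Γ j = t + 2) :
    Definable Γ (fun s : ℕ → V => s i = succ (s j)) :=
  .congr (fun s => by rw [ext_iff]; simp only [mem_succ_iff]) <|
    .all (t + 1) (P := fun s z => z ∈ₙ s i ↔ ∃ u v, u ∈ₙ s j ∧ ¬ v ∈ₙ u ∧ z = adj u v)
      (.iff (.mem 0 (i + 1) hi.symm) (.ex (t + 1) (.ex t (.and (.mem 1 (j + 3) hj.symm)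
        (.and (.not (.mem 0 1 rfl)) (.eq_adj 2 1 0 rfl rfl rfl))))))

theorem Definable.eq_zero {Γ : ℕ → ℕ} {t : ℕ} (i : ℕ) (hi : Γ i = t + 2) :
    Definable Γ (fun s : ℕ → V => s i = zero) :=
  .congr (fun s => by rw [ext_iff]; simp only [mem_zero]) <|
    .all (t + 1) (P := fun s z => z ∈ₙ s i ↔ z = empty)
      (.iff (.mem 0 (i + 1) hi.symm) (.eq_empty 0 rfl))

theorem Definable.mem_omega {Γ : ℕ → ℕ} {t : ℕ} (i : ℕ) (hi : Γ i = t + 2) :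
    Definable Γ (fun s : ℕ → V => s i ∈ₙ omega) :=
  .congr (P := fun s => ∀ I, ((∃ z, z = zero ∧ z ∈ₙ I) ∧
      ∀ k, k ∈ₙ I → ∃ z, z = succ k ∧ z ∈ₙ I) → s i ∈ₙ I)
    (fun s => by rw [NF.mem_omega]; simp only [exists_eq_left]) <|
    .all (t + 3) (.imp (.and (.ex (t + 2) (.and (.eq_zero 0 rfl) (.mem 0 1 rfl)))
      (.all (t + 2) (.imp (.mem 0 1 rfl) (.ex (t + 2) (.and (.eq_succ 0 1 rfl rfl)
        (.mem 0 2 rfl)))))) (.mem (i + 1) 0 (congrArg (· + 1) hi)))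

/-- Induction over the natural numbers for a property which defines a set. -/
theorem omega_induction {P : V → Prop} (hP : ∃ y : V, ∀ z, z ∈ₙ y ↔ P z) (h0 : P zero)
    (hs : ∀ n, n ∈ₙ omega → P n → P (succ n)) {n : V} (hn : n ∈ₙ omega) : P n := by
  obtain ⟨y, hy⟩ := hP
  obtain ⟨I, hI⟩ := exists_set₁ (fun z y => z ∈ₙ omega ∧ z ∈ₙ y) (2 ∷ 3 ∷ 0)
    (.and (.mem_omega 0 rfl) (.mem 0 1 rfl)) y
  have := (mem_omega n).1 hn I ⟨(hI _).2 ⟨zero_mem_omega, (hy _).2 h0⟩, fun k hk => (hI _).2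
    ⟨succ_mem_omega ((hI k).1 hk).1, (hy _).2 (hs k ((hI k).1 hk).1 ((hy k).1 ((hI k).1 hk).2))⟩⟩
  exact (hy n).1 ((hI n).1 this).2

theorem omega_cases {n : V} (hn : n ∈ₙ omega) : n = zero ∨ ∃ k, k ∈ₙ omega ∧ n = succ k :=
  omega_induction (P := fun n => n = zero ∨ ∃ k, k ∈ₙ omega ∧ n = succ k)
    (exists_set₁ (fun n _ => n = zero ∨ ∃ k, k ∈ₙ omega ∧ n = succ k) (fun _ => 2)
      (.or (.eq_zero 0 rfl) (.ex 2 (.and (.mem_omega 0 rfl) (.eq_succ 1 0 rfl rfl)))) zero)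
    (.inl rfl) (fun n hn _ => .inr ⟨n, hn, rfl⟩) hn

theorem del_adj_of_ne {u v w : V} (h : v ≠ w) : del (adj u w) v = adj (del u v) w := by
  ext z
  simp only [mem_adj, mem_del]
  by_cases hz : z = w <;> simp [hz, h.symm]

/-- Membership in `succ n` only provides some removable element; induction on `n` makes every
element removable. If `v` is not the element `x` added last, remove `v` from the rest and put `x`
back. -/
theorem del_mem_of_mem_succ {n w v : V} (hn : n ∈ₙ omega) (hw : w ∈ₙ succ n) (hv : v ∈ₙ w) :
    del w v ∈ₙ n := by
  refine omega_induction (P := fun n => ∀ w, w ∈ₙ succ n → ∀ v, v ∈ₙ w → del w v ∈ₙ n)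
    (exists_set₁ (fun n _ => ∀ w, w ∈ₙ succ n → ∀ v, v ∈ₙ w → del w v ∈ₙ n) (fun _ => 2)
      (.congr (P := fun s => ∀ w, (∃ k, k = succ (s 0) ∧ w ∈ₙ k) → ∀ v, v ∈ₙ w →
          ∃ u, u ∈ₙ s 0 ∧ w = adj u v ∧ ¬ v ∈ₙ u) (fun s => ?_)
        (.all 1 (.imp (.ex 2 (.and (.eq_succ 0 2 rfl rfl) (.mem 1 0 rfl)))
          (.all 0 (.imp (.mem 0 1 rfl) (.ex 1 (.and (.mem 0 3 rfl)
            (.and (.eq_adj 2 0 1 rfl rfl rfl) (.not (.mem 1 0 rfl)))))))))) zero)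
    ?_ ?_ hn w hw v hv
  · simp only [exists_eq_left]
    refine forall₄_congr fun w _ v hv => ⟨?_, fun h => ⟨_, h, (adj_del hv).symm, not_mem_del _ _⟩⟩
    rintro ⟨u, hu, rfl, hv'⟩
    rwa [del_adj hv']
  · intro w hw v hv
    obtain ⟨u, x, hu, hx, rfl⟩ := mem_succ_iff.1 hw
    obtain rfl := mem_zero.1 hu
    obtain rfl : v = x := by simpa [mem_adj, mem_empty] using hv
    rwa [del_adj hx]
  · intro n hn ih w hw v hv
    obtain ⟨u, x, hu, hx, rfl⟩ := mem_succ_iff.1 hw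
    by_cases hvx : v = x
    · subst hvx; rwa [del_adj hx]
    · rw [del_adj_of_ne hvx]
      exact adj_mem_succ (ih u hu v ((mem_adj.1 hv).resolve_right hvx))
        fun h => hx (mem_del.1 h).1

/-- Induct by removing the same element from the common member on both sides. This does not
presuppose that `succ` is injective, which could fail if some number were empty. -/
theorem omega_eq_of_mem {n m A : V} (hn : n ∈ₙ omega) (hm : m ∈ₙ omega) (hA : A ∈ₙ n)
    (hA' : A ∈ₙ m) : n = m := by
  refine omega_induction (P := fun n => ∀ m, m ∈ₙ omega → ∀ A, A ∈ₙ n → A ∈ₙ m → n = m)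
    (exists_set₁ (fun n _ => ∀ m, m ∈ₙ omega → ∀ A, A ∈ₙ n → A ∈ₙ m → n = m) (fun _ => 2)
      (.all 2 (.imp (.mem_omega 0 rfl) (.all 1 (.imp (.mem 0 2 rfl) (.imp (.mem 0 1 rfl)
        (.eq 2 1 rfl)))))) zero) ?_ ?_ hn m hm A hA hA'
  · intro m hm A hA hA'
    obtain rfl := mem_zero.1 hA
    obtain rfl | ⟨k, _, rfl⟩ := omega_cases hm
    · rfl
    · exact (empty_not_mem_succ _ hA').elim
  · intro n hn ih m hm A hA hA'
    obtain rfl | ⟨k, hk, rfl⟩ := omega_cases hm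
    · obtain rfl := mem_zero.1 hA'
      exact (empty_not_mem_succ _ hA).elim
    · obtain ⟨u, v, _, _, rfl⟩ := mem_succ_iff.1 hA
      have hv := mem_adj_self u v
      rw [ih k hk _ (del_mem_of_mem_succ hn hA hv) (del_mem_of_mem_succ hk hA' hv)]

/-- `A` is a finite set. -/
def Fin (A : V) : Prop := ∃ n, n ∈ₙ omega ∧ A ∈ₙ n

/-- `A` and `B` are finite sets with the same number of elements. -/
def Equinum (A B : V) : Prop := ∃ n, n ∈ₙ omega ∧ A ∈ₙ n ∧ B ∈ₙ n

theorem Definable.fin {Γ : ℕ → ℕ} {t : ℕ} (i : ℕ) (hi : Γ i = t + 1) :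
    Definable Γ (fun s : ℕ → V => Fin (s i)) :=
  .ex (t + 2) (.and (.mem_omega 0 rfl) (.mem (i + 1) 0 (congrArg (· + 1) hi)))

theorem Definable.equinum {Γ : ℕ → ℕ} {t : ℕ} (i j : ℕ) (hi : Γ i = t + 1) (hj : Γ j = t + 1) :
    Definable Γ (fun s : ℕ → V => Equinum (s i) (s j)) :=
  .ex (t + 2) (.and (.mem_omega 0 rfl) (.and (.mem (i + 1) 0 (congrArg (· + 1) hi))
    (.mem (j + 1) 0 (congrArg (· + 1) hj))))

theorem fin_empty : Fin (empty : V) := ⟨zero, zero_mem_omega, mem_zero.2 rfl⟩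

theorem Fin.adj {A : V} (h : Fin A) (v : V) : Fin (adj A v) := by
  by_cases hv : v ∈ₙ A
  · rwa [adj_of_mem hv]
  · obtain ⟨n, hn, hA⟩ := h
    exact ⟨_, succ_mem_omega hn, adj_mem_succ hA hv⟩

/-- Induction over finite sets for a property which defines a set. -/
theorem Fin.induction {P : V → Prop} (hP : ∃ y : V, ∀ z, z ∈ₙ y ↔ P z) (h0 : P empty)
    (hs : ∀ A v, Fin A → P A → ¬ v ∈ₙ A → P (NF.adj A v)) {A : V} (hA : Fin A) : P A := by
  obtain ⟨y, hy⟩ := hP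
  obtain ⟨n, hn, hA⟩ := hA
  refine (hy _).1 (omega_induction (P := fun n => ∀ A, A ∈ₙ n → A ∈ₙ y)
    (exists_set₁ (fun n y => ∀ A, A ∈ₙ n → A ∈ₙ y) (1 ∷ 1 ∷ 0)
      (.all 0 (.imp (.mem 0 1 rfl) (.mem 0 2 rfl))) y) ?_ ?_ hn A hA)
  · intro A hA
    exact mem_zero.1 hA ▸ (hy _).2 h0
  · intro n hn ih A hA
    obtain ⟨u, v, hu, hv, rfl⟩ := mem_succ_iff.1 hA
    exact (hy _).2 (hs u v ⟨n, hn, hu⟩ ((hy _).1 (ih u hu)) hv)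

theorem Fin.sub {A B : V} (hA : Fin A) (h : Sub B A) : Fin B := by
  refine Fin.induction (P := fun A => ∀ B, Sub B A → Fin B)
    (exists_set₁ (fun A _ => ∀ B, Sub B A → Fin B) (fun _ => 1)
      (.all 1 (.imp (.sub 0 1 rfl rfl) (.fin 0 rfl))) zero) ?_ ?_ hA B h
  · intro B h
    rw [h.antisymm fun z hz => ((mem_empty z).1 hz).elim]
    exact fin_empty
  · intro A v _ ih _ B h
    have hB : Fin (del B v) := ih _ fun z hz => (mem_adj.1 (h z (mem_del.1 hz).1)).resolve_right
      (mem_del.1 hz).2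
    by_cases hv : v ∈ₙ B
    · exact adj_del hv ▸ hB.adj v
    · refine ih B fun z hz => (mem_adj.1 (h z hz)).resolve_right fun e => hv (e ▸ hz)

namespace Equinum

theorem refl {A : V} (h : Fin A) : Equinum A A := h.imp fun _ h => ⟨h.1, h.2, h.2⟩

theorem symm {A B : V} : Equinum A B → Equinum B A
  | ⟨n, hn, hA, hB⟩ => ⟨n, hn, hB, hA⟩

theorem trans {A B C : V} : Equinum A B → Equinum B C → Equinum A C
  | ⟨n, hn, hA, hB⟩, ⟨_, hm, hB', hC⟩ =>
    ⟨n, hn, hA, omega_eq_of_mem hm hn hB' hB ▸ hC⟩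

theorem left {A B : V} : Equinum A B → Fin A := fun ⟨n, hn, hA, _⟩ => ⟨n, hn, hA⟩

theorem adj {A B v w : V} (h : Equinum A B) (hv : ¬ v ∈ₙ A) (hw : ¬ w ∈ₙ B) :
    Equinum (adj A v) (adj B w) :=
  let ⟨n, hn, hA, hB⟩ := h
  ⟨succ n, succ_mem_omega hn, adj_mem_succ hA hv, adj_mem_succ hB hw⟩

theorem mem_iff {A B n : V} (h : Equinum A B) (hn : n ∈ₙ omega) : A ∈ₙ n ↔ B ∈ₙ n := by
  obtain ⟨m, hm, hA, hB⟩ := h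
  exact ⟨fun h => omega_eq_of_mem hm hn hA h ▸ hB, fun h => omega_eq_of_mem hm hn hB h ▸ hA⟩

theorem eq_empty {B : V} (h : Equinum empty B) : B = empty :=
  mem_zero.1 ((h.mem_iff zero_mem_omega).1 (mem_zero.2 rfl))

/-- Inversion of `Equinum.adj` -/
theorem exists_eq_adj {A B v : V} (h : Equinum (NF.adj A v) B) (hv : ¬ v ∈ₙ A) :
    ∃ B' w, B = NF.adj B' w ∧ ¬ w ∈ₙ B' ∧ Equinum A B' := by
  obtain ⟨n, hn, hA, hB⟩ := h
  obtain rfl | ⟨k, hk, rfl⟩ := omega_cases hn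
  · exact ((mem_empty v).1 (mem_zero.1 hA ▸ mem_adj_self A v)).elim
  · obtain ⟨u, w, hu, hw, rfl⟩ := mem_succ_iff.1 hB
    exact ⟨u, w, rfl, hw, k, hk, del_adj hv ▸ del_mem_of_mem_succ hk hA (mem_adj_self A v), hu⟩

theorem of_adj {A B v w : V} (h : Equinum (NF.adj A v) (NF.adj B w)) (hv : ¬ v ∈ₙ A)
    (hw : ¬ w ∈ₙ B) : Equinum A B := by
  obtain ⟨n, hn, hA, hB⟩ := h
  obtain rfl | ⟨k, hk, rfl⟩ := omega_cases hn
  · exact ((mem_empty v).1 (mem_zero.1 hA ▸ mem_adj_self A v)).elim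
  · exact ⟨k, hk, del_adj hv ▸ del_mem_of_mem_succ hk hA (mem_adj_self A v),
      del_adj hw ▸ del_mem_of_mem_succ hk hB (mem_adj_self B w)⟩

/-- Simultaneous induction over two finite sets of the same size, for a relation `Q` such that
`{A | ∀ B, Equinum A B → Q A B}` is a set. -/
theorem induction {Q : V → V → Prop}
    (hQ : ∃ y : V, ∀ z, z ∈ₙ y ↔ ∀ B, Equinum z B → Q z B) (h0 : Q empty empty)
    (hs : ∀ A B v w, Equinum A B → Q A B → ¬ v ∈ₙ A → ¬ w ∈ₙ B → Q (NF.adj A v) (NF.adj B w))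
    {A B : V} (h : Equinum A B) : Q A B := by
  refine Fin.induction (P := fun A => ∀ B, Equinum A B → Q A B) hQ ?_ ?_ h.left B h
  · intro B h
    rwa [h.eq_empty]
  · intro A v _ ih h B hAB
    obtain ⟨B, w, rfl, hw, h'⟩ := hAB.exists_eq_adj h
    exact hs A B v w h' (ih B h') h hw

/-- Dedekind finiteness: the element adjoined to `A` also lies in `B`, and removing it from both
reduces to the smaller sets. -/
theorem eq_of_sub {A B : V} (h : Equinum A B) (hAB : Sub A B) : A = B := by
  refine Fin.induction (P := fun A => ∀ B, Equinum A B → Sub A B → A = B)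
    (exists_set₁ (fun A _ => ∀ B, Equinum A B → Sub A B → A = B) (fun _ => 1)
      (.all 1 (.imp (.equinum 1 0 rfl rfl) (.imp (.sub 1 0 rfl rfl) (.eq 1 0 rfl)))) zero)
    ?_ ?_ h.left B h hAB
  · intro B h _
    exact h.eq_empty.symm
  · intro A v _ ih h B hAB hB
    have hv : v ∈ₙ B := hB v (mem_adj_self A v)
    rw [← adj_del hv] at hAB ⊢
    rw [← ih _ (hAB.of_adj h (not_mem_del _ _)) fun z hz => mem_del.2
      ⟨hB z (mem_adj.2 (.inl hz)), fun e => h (e ▸ hz)⟩]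

/-- Match the elements of `A` one at a time with new elements of `B` until one of the two sets is
exhausted. -/
theorem exists_sub_or {A B : V} (hA : Fin A) :
    (∃ B', Sub B' B ∧ Equinum A B') ∨ ∃ A', Sub A' A ∧ Equinum A' B := by
  refine Fin.induction
    (P := fun A => (∃ B', Sub B' B ∧ Equinum A B') ∨ ∃ A', Sub A' A ∧ Equinum A' B)
    (exists_set₁ (fun A B => (∃ B', Sub B' B ∧ Equinum A B') ∨ ∃ A', Sub A' A ∧ Equinum A' B)
      (fun _ => 1) (.or (.ex 1 (.and (.sub 0 2 rfl rfl) (.equinum 1 0 rfl rfl)))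
        (.ex 1 (.and (.sub 0 1 rfl rfl) (.equinum 0 2 rfl rfl)))) B) ?_ ?_ hA
  · exact .inl ⟨empty, fun z hz => ((mem_empty z).1 hz).elim, refl fin_empty⟩
  · rintro A v - (⟨B', hB', h⟩ | ⟨A', hA', h⟩) hv
    · by_cases hBB : ∃ w, w ∈ₙ B ∧ ¬ w ∈ₙ B'
      · obtain ⟨w, hw, hw'⟩ := hBB
        exact .inl ⟨_, fun z hz => (mem_adj.1 hz).elim (hB' z) fun e => e ▸ hw, h.adj hv hw'⟩
      · push Not at hBB
        rw [hB'.antisymm hBB] at h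
        exact .inr ⟨A, fun z hz => mem_adj.2 (.inl hz), h⟩
    · exact .inr ⟨A', fun z hz => mem_adj.2 (.inl (hA' z hz)), h⟩

/-- A finite set is equinumerous with its image under a definable bijection. -/
theorem of_bijection {R : V → V → V → Prop} {t r : ℕ}
    (hR : Definable (t ∷ t ∷ r ∷ 0) (fun s => R (s 0) (s 1) (s 2))) (p : V) {A B : V}
    (hA : Fin A) (h₁ : ∀ a, a ∈ₙ A → ∃ b, b ∈ₙ B ∧ R a b p)
    (h₂ : ∀ b, b ∈ₙ B → ∃ a, a ∈ₙ A ∧ R a b p)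
    (h₃ : ∀ a b b', R a b p → R a b' p → b = b')
    (h₄ : ∀ a a' b, R a b p → R a' b p → a = a') : Equinum A B := by
  have hS := exists_set₃ (fun X A B p => Sub X A → ∃ Y, Sub Y B ∧ Equinum X Y ∧
      ∀ y, y ∈ₙ Y ↔ ∃ x, x ∈ₙ X ∧ R x y p) ((t + 1) ∷ (t + 1) ∷ (t + 1) ∷ r ∷ 0)
    (.imp (.sub 0 1 rfl rfl) (.ex (t + 1) (.and (.sub 0 3 rfl rfl)
      (.and (.equinum 1 0 rfl rfl) (.all t (.iff (.mem 0 1 rfl) (.ex t (.and (.mem 0 3 rfl)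
        -- At this depth the environment reads `x, y, Y, X, A, B, p`, so the three arguments of `R`
        -- are at positions `0`, `1` and `6`.
        (hR.rename (0 ∷ 1 ∷ 6 ∷ fun n => n + 7) (by rintro (_ | _ | _ | n) <;> rfl)))))))))) A B p
  have key : ∃ Y, Sub Y B ∧ Equinum A Y ∧ ∀ y, y ∈ₙ Y ↔ ∃ x, x ∈ₙ A ∧ R x y p := by
    refine Fin.induction hS ?_ ?_ hA (Sub.refl A)
    · exact fun _ => ⟨empty, fun z hz => ((mem_empty z).1 hz).elim, refl fin_empty, fun y => by
        simp [mem_empty]⟩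
    · intro X v _ ih hv hX
      obtain ⟨Y, hY, h, hYX⟩ := ih fun z hz => hX z (mem_adj.2 (.inl hz))
      obtain ⟨w, hw, hR'⟩ := h₁ v (hX v (mem_adj_self X v))
      refine ⟨NF.adj Y w, fun z hz => (mem_adj.1 hz).elim (hY z) fun e => e ▸ hw,
        h.adj hv fun hwY => ?_, fun y => ?_⟩
      · obtain ⟨x, hx, hxw⟩ := (hYX w).1 hwY
        exact hv (h₄ _ _ _ hxw hR' ▸ hx)
      · rw [mem_adj, hYX]
        constructor
        · rintro (⟨x, hx, h⟩ | rfl)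
          exacts [⟨x, mem_adj.2 (.inl hx), h⟩, ⟨v, mem_adj_self X v, hR'⟩]
        · rintro ⟨x, hx, h⟩
          obtain hx | rfl := mem_adj.1 hx
          exacts [.inl ⟨x, hx, h⟩, .inr (h₃ _ _ _ h hR')]
  obtain ⟨Y, hY, h, hYA⟩ := key
  rwa [hY.antisymm fun b hb => (hYA b).2 (h₂ b hb)] at h

end Equinum

end Frege

/-! ### Power sets and sets of singletons of finite sets -/

section Finite

variable {V : Type*} [Model V]

theorem Equinum.union {A A' B B' : V} (hA : Equinum A A') (hB : Equinum B B')
    (h : ∀ z, z ∈ₙ A → ¬ z ∈ₙ B) (h' : ∀ z, z ∈ₙ A' → ¬ z ∈ₙ B') :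
    Equinum (union A B) (union A' B') := by
  have hU : ∀ C : V, NF.union empty C = C := fun C => by ext z; simp [mem_union, mem_empty]
  have hUa : ∀ A v C : V, NF.union (NF.adj A v) C = NF.adj (NF.union A C) v := fun A v C => by
    ext z; simp only [mem_union, mem_adj]; tauto
  have hS := exists_set₂ (fun A B B' => ∀ A', Equinum A A' → (∀ z, z ∈ₙ A → ¬ z ∈ₙ B) →
    (∀ z, z ∈ₙ A' → ¬ z ∈ₙ B') → Equinum (NF.union A B) (NF.union A' B')) (fun _ => 1)
    (.congr (P := fun s => ∀ A', Equinum (s 0) A' → (∀ z, z ∈ₙ s 0 → ¬ z ∈ₙ s 1) →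
      (∀ z, z ∈ₙ A' → ¬ z ∈ₙ s 2) → ∃ C C', (∀ z, z ∈ₙ C ↔ (z ∈ₙ s 0 ∨ z ∈ₙ s 1)) ∧
        (∀ z, z ∈ₙ C' ↔ (z ∈ₙ A' ∨ z ∈ₙ s 2)) ∧ Equinum C C')
      (fun s => by simp only [← mem_union, ← ext_iff]; simp)
      (.all 1 (.imp (.equinum 1 0 rfl rfl) (.imp
        (.all 0 (.imp (.mem 0 2 rfl) (.not (.mem 0 3 rfl))))
        (.imp (.all 0 (.imp (.mem 0 1 rfl) (.not (.mem 0 4 rfl))))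
        (.ex 1 (.ex 1 (.and (.all 0 (.iff (.mem 0 2 rfl) (.or (.mem 0 4 rfl) (.mem 0 5 rfl))))
          (.and (.all 0 (.iff (.mem 0 1 rfl) (.or (.mem 0 3 rfl) (.mem 0 6 rfl))))
            (.equinum 1 0 rfl rfl))))))))))
    B B'
  refine Fin.induction hS ?_ ?_ hA.left A' hA h h'
  · intro A' hA _ _
    rwa [hA.eq_empty, hU, hU]
  · intro A v _ ih hv A' hA h h'
    obtain ⟨A', w, rfl, hw, hAA⟩ := hA.exists_eq_adj hv
    rw [hUa, hUa]
    refine (ih A' hAA (fun z hz => h z (mem_adj.2 (.inl hz)))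
      (fun z hz => h' z (mem_adj.2 (.inl hz)))).adj ?_ ?_
    · rw [mem_union]
      exact fun hz => hz.elim hv (h v (mem_adj_self A v))
    · rw [mem_union]
      exact fun hz => hz.elim hw (h' w (mem_adj_self A' w))

/-- `{x ∪ {v} | x ⊆ A}` -/
noncomputable def powAdj (A v : V) : V := setOf (fun z => ∃ x, Sub x A ∧ z = adj x v)

theorem mem_powAdj {A v z : V} : z ∈ₙ powAdj A v ↔ ∃ x, Sub x A ∧ z = adj x v :=
  mem_setOf_of_exists (exists_set₂ (fun z A v => ∃ x, Sub x A ∧ z = adj x v) (1 ∷ 1 ∷ 0 ∷ 0)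
    (.ex 1 (.and (.sub 0 2 rfl rfl) (.eq_adj 1 0 3 rfl rfl rfl))) A v) z

/-- The subsets are split according to whether they contain `v`. For `v` outside `A` the two halves
are disjoint and equinumerous, so the power set doubles. -/
theorem pow_adj (A v : V) : pow (adj A v) = union (pow A) (powAdj A v) := by
  ext z
  rw [mem_pow, mem_union, mem_pow, mem_powAdj]
  constructor
  · intro h
    by_cases hz : v ∈ₙ z
    · exact .inr ⟨del z v, fun x hx => (mem_adj.1 (h x (mem_del.1 hx).1)).resolve_right
        (mem_del.1 hx).2, (adj_del hz).symm⟩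
    · exact .inl fun x hx => (mem_adj.1 (h x hx)).resolve_right fun e => hz (e ▸ hx)
  · rintro (h | ⟨x, h, rfl⟩) y hy
    · exact mem_adj.2 (.inl (h y hy))
    · exact mem_adj.2 ((mem_adj.1 hy).imp_left (h y))

theorem pow_disjoint_powAdj {A v : V} (hv : ¬ v ∈ₙ A) (z : V) (hz : z ∈ₙ pow A) :
    ¬ z ∈ₙ powAdj A v := fun h => by
  obtain ⟨x, _, rfl⟩ := mem_powAdj.1 h
  exact hv (mem_pow.1 hz v (mem_adj_self x v))

theorem equinum_powAdj {A v : V} (hA : Fin (pow A)) (hv : ¬ v ∈ₙ A) :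
    Equinum (pow A) (powAdj A v) := by
  refine Equinum.of_bijection (t := 1) (r := 0)
    (R := fun x y v => ¬ v ∈ₙ x ∧ y = adj x v)
    (.and (.not (.mem 2 0 rfl)) (.eq_adj 1 0 2 rfl rfl rfl)) v hA ?_ ?_ ?_ ?_
  · exact fun x hx => ⟨_, mem_powAdj.2 ⟨x, mem_pow.1 hx, rfl⟩, fun h => hv (mem_pow.1 hx v h), rfl⟩
  · intro y hy
    obtain ⟨x, hx, rfl⟩ := mem_powAdj.1 hy
    exact ⟨x, mem_pow.2 hx, fun h => hv (hx v h), rfl⟩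
  · rintro x y y' ⟨_, rfl⟩ ⟨_, rfl⟩
    rfl
  · rintro x x' y ⟨h, rfl⟩ ⟨h', e⟩
    rw [← del_adj h, e, del_adj h']

theorem T_empty : T (empty : V) = empty := by
  ext z; simp [mem_T, mem_empty]

theorem T_adj (A v : V) : T (adj A v) = adj (T A) (sing v) := by
  ext z
  simp only [mem_T, mem_adj, or_and_right, exists_or, exists_eq_left]

theorem Equinum.T {A B : V} (h : Equinum A B) : Equinum (T A) (T B) := by
  refine Equinum.induction (Q := fun A B => Equinum (NF.T A) (NF.T B))
    (exists_set₁ (fun A _ => ∀ B, Equinum A B → Equinum (NF.T A) (NF.T B)) (fun _ => 1)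
      (.congr (P := fun s => ∀ B, Equinum (s 0) B → ∃ C D, C = NF.T (s 0) ∧ D = NF.T B ∧
        Equinum C D) (fun s => by simp) (.all 1 (.imp (.equinum 1 0 rfl rfl)
          (.ex 2 (.ex 2 (.and (.eq_T 1 3 rfl rfl) (.and (.eq_T 0 2 rfl rfl)
            (.equinum 1 0 rfl rfl)))))))) zero) ?_ ?_ h
  · rw [T_empty]
    exact refl fin_empty
  · intro A B v w _ ih hv hw
    rw [T_adj, T_adj]
    exact ih.adj (mt sing_mem_T.1 hv) (mt sing_mem_T.1 hw)

theorem Fin.T {A : V} (h : Fin A) : Fin (T A) := (Equinum.refl h).T.left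

/-- Adjoining one element to each set doubles both power sets. Finiteness of all sets spares a
separate proof that power sets of finite sets are finite. -/
theorem Equinum.pow {A B : V} (hV : ∀ A : V, Fin A) (h : Equinum A B) :
    Equinum (pow A) (pow B) := by
  refine Equinum.induction (Q := fun A B => Equinum (NF.pow A) (NF.pow B))
    (exists_set₁ (fun A _ => ∀ B, Equinum A B → Equinum (NF.pow A) (NF.pow B)) (fun _ => 1)
      (.congr (P := fun s => ∀ B, Equinum (s 0) B → ∃ C D, C = NF.pow (s 0) ∧ D = NF.pow B ∧
        Equinum C D) (fun s => by simp) (.all 1 (.imp (.equinum 1 0 rfl rfl)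
          (.ex 2 (.ex 2 (.and (.eq_pow 1 3 rfl rfl) (.and (.eq_pow 0 2 rfl rfl)
            (.equinum 1 0 rfl rfl)))))))) zero) ?_ ?_ h
  · exact refl (hV _)
  · intro A B v w _ ih hv hw
    rw [pow_adj, pow_adj]
    exact ih.union ((equinum_powAdj (hV _) hv).symm.trans (ih.trans (equinum_powAdj (hV _) hw)))
      (pow_disjoint_powAdj hv) (pow_disjoint_powAdj hw)

theorem T_sub {A B : V} (h : Sub A B) : Sub (T A) (T B) := fun z hz => by
  obtain ⟨x, hx, rfl⟩ := (mem_T _ _).1 hz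
  exact sing_mem_T.2 (h x hx)

theorem T_injective {A B : V} (h : T A = T B) : A = B :=
  set_ext fun z => by rw [← sing_mem_T, h, sing_mem_T]

theorem pow_sub {A B : V} (h : Sub A B) : Sub (pow A) (pow B) := fun _ hz =>
  mem_pow.2 fun x hx => h x (mem_pow.1 hz x hx)

theorem pow_injective {A B : V} (h : pow A = pow B) : A = B :=
  (mem_pow.1 (h ▸ mem_pow.2 (Sub.refl A))).antisymm (mem_pow.1 (h.symm ▸ mem_pow.2 (Sub.refl B)))

/-- An operation which preserves inclusion and equinumerosity and is injective reflects
equinumerosity of finite sets. -/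
theorem equinum_of_map {A B : V} (f : V → V) (hf : ∀ {A B}, Equinum A B → Equinum (f A) (f B))
    (hs : ∀ {A B}, Sub A B → Sub (f A) (f B)) (hi : ∀ {A B}, f A = f B → A = B)
    (hA : Fin A) (h : Equinum (f A) (f B)) : Equinum A B := by
  -- Comparability puts a copy of one set inside the other. After applying `f` the inclusion is
  -- between equinumerous finite sets, hence an equality, and injectivity of `f` brings it back.
  obtain ⟨B', hB, h'⟩ | ⟨A', hA, h'⟩ := Equinum.exists_sub_or (B := B) hA
  · rwa [hi (((hf h').symm.trans h).eq_of_sub (hs hB))] at h'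
  · rwa [hi (((hf h').trans h.symm).eq_of_sub (hs hA))] at h'

theorem Equinum.of_T {A B : V} (hA : Fin A) (h : Equinum (NF.T A) (NF.T B)) : Equinum A B :=
  equinum_of_map _ Equinum.T T_sub T_injective hA h

theorem Equinum.of_pow {A B : V} (hV : ∀ A : V, Fin A) (h : Equinum (NF.pow A) (NF.pow B)) :
    Equinum A B :=
  equinum_of_map _ (Equinum.pow hV) pow_sub pow_injective (hV A) h

theorem exists_eq_T {A B : V} (h : Sub B (T A)) : ∃ A', Sub A' A ∧ B = T A' := by
  obtain ⟨A', hA'⟩ := exists_set₁ (fun x B => ∃ z, z = sing x ∧ z ∈ₙ B) (0 ∷ 2 ∷ 0)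
    (.ex 1 (.and (.eq_sing 0 1 rfl rfl) (.mem 0 2 rfl))) B
  simp only [exists_eq_left] at hA'
  refine ⟨A', fun x hx => sing_mem_T.1 (h _ ((hA' x).1 hx)), ?_⟩
  ext z
  rw [mem_T]
  refine ⟨fun hz => ?_, fun ⟨x, hx, e⟩ => e ▸ (hA' x).1 hx⟩
  obtain ⟨x, _, rfl⟩ := (mem_T _ _).1 (h z hz)
  exact ⟨x, (hA' x).2 hz, rfl⟩

/-- The bijection is `{x} ↦ T x`. Both sides lie one type above `x`, so it is stratified. -/
theorem equinum_T_pow {A : V} (hV : ∀ A : V, Fin A) : Equinum (T (pow A)) (pow (T A)) := by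
  refine Equinum.of_bijection (t := 2) (r := 0)
    (R := fun z y _ => ∃ x, z = sing x ∧ y = T x)
    (.ex 1 (.and (.eq_sing 1 0 rfl rfl) (.eq_T 2 0 rfl rfl))) A (hV _) ?_ ?_ ?_ ?_
  · intro z hz
    obtain ⟨x, hx, rfl⟩ := (mem_T _ _).1 hz
    exact ⟨T x, mem_pow.2 (T_sub (mem_pow.1 hx)), x, rfl, rfl⟩
  · intro y hy
    obtain ⟨x, hx, rfl⟩ := exists_eq_T (mem_pow.1 hy)
    exact ⟨sing x, sing_mem_T.2 (mem_pow.2 hx), x, rfl, rfl⟩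
  · rintro z y y' ⟨x, rfl, rfl⟩ ⟨x', h, rfl⟩
    rw [sing_injective h]
  · rintro z z' y ⟨x, rfl, rfl⟩ ⟨x', rfl, h⟩
    rw [T_injective h]

/-- By comparability either `A'` embeds in `B`, or all of `B` has the size of some `A'' ⊆ A' ⊆ A`;
the latter forces `A'' = A' = A`. -/
theorem Equinum.exists_sub {A B A' : V} (h : Equinum A B) (hA : Sub A' A) :
    ∃ B', Sub B' B ∧ Equinum A' B' := by
  obtain h' | ⟨A'', hA'', h'⟩ := exists_sub_or (B := B) (h.left.sub hA)
  · exact h'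
  · have e := (h'.trans h.symm).eq_of_sub fun z hz => hA z (hA'' z hz)
    subst e
    rw [hA.antisymm hA'']
    exact ⟨B, Sub.refl B, h⟩

/-! ### Parity -/

/-- The set of even natural numbers. -/
noncomputable def evenNum : V :=
  setOf (fun n => ∀ I : V, (zero ∈ₙ I ∧ ∀ k, k ∈ₙ I → succ (succ k) ∈ₙ I) → n ∈ₙ I)

theorem mem_evenNum {n : V} : n ∈ₙ (evenNum : V) ↔
    ∀ I : V, (zero ∈ₙ I ∧ ∀ k, k ∈ₙ I → succ (succ k) ∈ₙ I) → n ∈ₙ I := by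
  refine mem_setOf_of_exists (exists_set₁ (fun n _ => ∀ I : V,
    (zero ∈ₙ I ∧ ∀ k, k ∈ₙ I → succ (succ k) ∈ₙ I) → n ∈ₙ I) (fun _ => 2) ?_ zero) n
  refine .congr (P := fun s => ∀ I, ((∃ z, z = zero ∧ z ∈ₙ I) ∧
      ∀ k, k ∈ₙ I → ∃ m z, m = succ k ∧ z = succ m ∧ z ∈ₙ I) → s 0 ∈ₙ I) (fun s => by simp) ?_
  exact .all 3 (.imp (.and (.ex 2 (.and (.eq_zero 0 rfl) (.mem 0 1 rfl)))
    (.all 2 (.imp (.mem 0 1 rfl) (.ex 2 (.ex 2 (.and (.eq_succ 1 2 rfl rfl)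
      (.and (.eq_succ 0 1 rfl rfl) (.mem 0 3 rfl)))))))) (.mem 1 0 rfl))

theorem zero_mem_evenNum : zero ∈ₙ (evenNum : V) := mem_evenNum.2 fun _ h => h.1

theorem succ_succ_mem_evenNum {n : V} (h : n ∈ₙ evenNum) : succ (succ n) ∈ₙ evenNum :=
  mem_evenNum.2 fun I hI => hI.2 _ (mem_evenNum.1 h I hI)

theorem evenNum_sub_omega : Sub (evenNum : V) omega := fun _ h =>
  mem_evenNum.1 h _ ⟨zero_mem_omega, fun _ h => succ_mem_omega (succ_mem_omega h)⟩

theorem evenNum_cases {n : V} (hn : n ∈ₙ evenNum) :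
    n = zero ∨ ∃ k, k ∈ₙ evenNum ∧ n = succ (succ k) := by
  obtain ⟨I, hI⟩ := exists_set₁
    (fun n E => n = zero ∨ ∃ k, k ∈ₙ E ∧ n = succ (succ k)) (2 ∷ 3 ∷ 0)
    (.congr (P := fun s => s 0 = zero ∨ ∃ k, k ∈ₙ s 1 ∧ ∃ m, m = succ k ∧ s 0 = succ m)
      (fun (s : ℕ → V) => by simp) (.or (.eq_zero 0 rfl) (.ex 2 (.and (.mem 0 2 rfl)
        (.ex 2 (.and (.eq_succ 0 1 rfl rfl) (.eq_succ 2 0 rfl rfl))))))) evenNum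
  refine (hI n).1 (mem_evenNum.1 hn I ⟨(hI _).2 (.inl rfl), fun k hk => (hI _).2 (.inr ⟨k, ?_, rfl⟩)⟩)
  obtain rfl | ⟨m, hm, rfl⟩ := (hI k).1 hk
  exacts [zero_mem_evenNum, succ_succ_mem_evenNum hm]

/-- The set of finite sets with an even number of elements. -/
noncomputable def evenSet : V := setOf (fun A => ∃ n, n ∈ₙ evenNum ∧ A ∈ₙ n)

theorem mem_evenSet {A : V} : A ∈ₙ (evenSet : V) ↔ ∃ n, n ∈ₙ evenNum ∧ A ∈ₙ n :=
  mem_setOf_of_exists (exists_set₁ (fun A E => ∃ n, n ∈ₙ E ∧ A ∈ₙ n) (1 ∷ 3 ∷ 0)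
    (.ex 2 (.and (.mem 0 2 rfl) (.mem 1 0 rfl))) evenNum) A

theorem empty_mem_evenSet : empty ∈ₙ (evenSet : V) :=
  mem_evenSet.2 ⟨zero, zero_mem_evenNum, mem_zero.2 rfl⟩

/-- The inductive hypothesis reduces the claim to two added elements: these preserve evenness, as is
seen by removing or adjoining both. -/
theorem adj_mem_evenSet {A v : V} (hA : Fin A) (hv : ¬ v ∈ₙ A) :
    adj A v ∈ₙ evenSet ↔ ¬ A ∈ₙ evenSet := by
  refine Fin.induction (P := fun A => ∀ v, ¬ v ∈ₙ A → (adj A v ∈ₙ evenSet ↔ ¬ A ∈ₙ evenSet))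
    (exists_set₁ (fun A E => ∀ v, ¬ v ∈ₙ A → (adj A v ∈ₙ E ↔ ¬ A ∈ₙ E)) (1 ∷ 2 ∷ 0)
      (.congr (P := fun s => ∀ v, ¬ v ∈ₙ s 0 → ((∃ B, B = adj (s 0) v ∧ B ∈ₙ s 1) ↔ ¬ s 0 ∈ₙ s 1))
        (fun s => by simp) (.all 0 (.imp (.not (.mem 0 1 rfl)) (.iff (.ex 1 (.and
          (.eq_adj 0 2 1 rfl rfl rfl) (.mem 0 3 rfl))) (.not (.mem 1 2 rfl)))))) evenSet)
    ?_ ?_ hA v hv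
  · intro v _
    refine iff_of_false (fun h => ?_) (not_not.2 empty_mem_evenSet)
    obtain ⟨n, hn, h⟩ := mem_evenSet.1 h
    have hv := mem_adj_self (empty : V) v
    obtain rfl | ⟨k, hk, rfl⟩ := evenNum_cases hn
    · exact (mem_empty v).1 (mem_zero.1 h ▸ hv)
    · refine empty_not_mem_succ k ?_
      rw [← del_adj (mem_empty v).1]
      exact del_mem_of_mem_succ (succ_mem_omega (evenNum_sub_omega _ hk)) h hv
  · intro A w _ ih hw v hv
    rw [ih w hw, not_not]
    constructor
    · intro h
      obtain ⟨n, hn, h⟩ := mem_evenSet.1 h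
      obtain rfl | ⟨k, hk, rfl⟩ := evenNum_cases hn
      · exact ((mem_empty v).1 (mem_zero.1 h ▸ mem_adj_self (adj A w) v)).elim
      · have hk' := evenNum_sub_omega _ hk
        have h1 := del_mem_of_mem_succ (succ_mem_omega hk') h (mem_adj_self _ v)
        rw [del_adj hv] at h1
        have h2 := del_mem_of_mem_succ hk' h1 (mem_adj_self _ w)
        rw [del_adj hw] at h2
        exact mem_evenSet.2 ⟨k, hk, h2⟩
    · intro h
      obtain ⟨n, hn, h⟩ := mem_evenSet.1 h
      exact mem_evenSet.2 ⟨_, succ_succ_mem_evenNum hn, adj_mem_succ (adj_mem_succ h hw) hv⟩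

theorem Equinum.mem_evenSet_iff {A B : V} (h : Equinum A B) : A ∈ₙ evenSet ↔ B ∈ₙ evenSet := by
  simp only [mem_evenSet]
  exact exists_congr fun n => and_congr_right fun hn => h.mem_iff (evenNum_sub_omega n hn)

/-- Parity is the invariant that survives `T`, even though `A` and `T A` need not be equinumerous:
adjoining an element to `A` adjoins one singleton to `T A`, and both parities flip. -/
theorem T_mem_evenSet {A : V} (hA : Fin A) : T A ∈ₙ evenSet ↔ A ∈ₙ evenSet := by
  refine Fin.induction (P := fun A => T A ∈ₙ evenSet ↔ A ∈ₙ evenSet)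
    -- `evenSet` enters twice, as separate parameters, because `T A` is one type above `A`.
    (exists_set₂ (fun A E E' => T A ∈ₙ E ↔ A ∈ₙ E') (1 ∷ 3 ∷ 2 ∷ 0)
      (.congr (P := fun s => (∃ B, B = T (s 0) ∧ B ∈ₙ s 1) ↔ s 0 ∈ₙ s 2) (fun s => by simp)
        (.iff (.ex 2 (.and (.eq_T 0 1 rfl rfl) (.mem 0 2 rfl))) (.mem 0 2 rfl)))
      evenSet evenSet) ?_ ?_ hA
  · rw [T_empty]
  · intro A v hA ih hv
    rw [T_adj, adj_mem_evenSet hA hv, adj_mem_evenSet hA.T (mt sing_mem_T.1 hv), ih]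

end Finite

/-! ### The axiom of infinity -/

section Infinity

variable {V : Type*} [Model V]

/-- The finite cardinal of `A`. -/
noncomputable def card (A : V) : V := Classical.epsilon (fun n => n ∈ₙ omega ∧ A ∈ₙ n)

theorem card_mem_omega {A : V} (hA : Fin A) : card A ∈ₙ omega := (Classical.epsilon_spec hA).1

theorem mem_card {A : V} (hA : Fin A) : A ∈ₙ card A := (Classical.epsilon_spec hA).2

/-- `n = T m` for finite cardinals `m`, `n`. -/
def TRel (m n : V) : Prop := m ∈ₙ omega ∧ n ∈ₙ omega ∧ ∃ a, a ∈ₙ m ∧ T a ∈ₙ n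

theorem Definable.tRel {Γ : ℕ → ℕ} {t : ℕ} (i j : ℕ) (hi : Γ i = t + 2) (hj : Γ j = t + 3) :
    Definable Γ (fun s : ℕ → V => TRel (s i) (s j)) :=
  .congr (P := fun s => s i ∈ₙ omega ∧ s j ∈ₙ omega ∧ ∃ a, a ∈ₙ s i ∧ ∃ b, b = T a ∧ b ∈ₙ s j)
    (fun s => by simp [TRel])
    (.and (.mem_omega i hi) (.and (.mem_omega j hj) (.ex (t + 1) (.and (.mem 0 (i + 1) hi.symm)
      (.ex (t + 2) (.and (.eq_T 0 1 rfl rfl) (.mem 0 (j + 2) hj.symm)))))))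

/-- `I` contains the cardinal of the set of all singletons, and with the cardinal of `P(a)`
it contains the cardinal of `T(a)`. -/
def SpeckerClosed (I : V) : Prop :=
  (∀ n, n ∈ₙ omega → T univ ∈ₙ n → n ∈ₙ I) ∧
    ∀ n a m, n ∈ₙ I → pow a ∈ₙ n → m ∈ₙ omega → T a ∈ₙ m → m ∈ₙ I

/-- Both `P(a)` and `T(a)` lie one type above `a`, so the closure rule relates cardinals of the same
type. This is why the least closed set exists. -/
theorem Definable.specker {Γ : ℕ → ℕ} {t : ℕ} (i : ℕ) (hi : Γ i = t + 4) :
    Definable Γ (fun s : ℕ → V => SpeckerClosed (s i)) :=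
  .congr (P := fun s => (∀ n, n ∈ₙ omega → (∃ U, (∀ z, z ∈ₙ U ↔ ∃ x, z = sing x) ∧ U ∈ₙ n) →
      n ∈ₙ s i) ∧ ∀ n a m, n ∈ₙ s i → (∃ b, b = pow a ∧ b ∈ₙ n) → m ∈ₙ omega →
      (∃ b, b = T a ∧ b ∈ₙ m) → m ∈ₙ s i)
    (fun s => by
      have h : ∀ U : V, (∀ z, z ∈ₙ U ↔ ∃ x, z = sing x) ↔ U = T univ := fun U => by
        rw [ext_iff]; simp [mem_T, mem_univ]
      simp [h, SpeckerClosed])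
    (.and (.all (t + 3) (.imp (.mem_omega 0 rfl) (.imp (.ex (t + 2) (.and (.all (t + 1)
        (.iff (.mem 0 1 rfl) (.ex t (.eq_sing 1 0 rfl rfl)))) (.mem 0 1 rfl)))
        (.mem 0 (i + 1) hi.symm))))
      (.all (t + 3) (.all (t + 1) (.all (t + 3) (.imp (.mem 2 (i + 3) hi.symm)
        (.imp (.ex (t + 2) (.and (.eq_pow 0 2 rfl rfl) (.mem 0 3 rfl)))
        (.imp (.mem_omega 0 rfl) (.imp (.ex (t + 2) (.and (.eq_T 0 2 rfl rfl) (.mem 0 1 rfl)))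
          (.mem 0 (i + 3) hi.symm)))))))))

/-- The least set as in `SpeckerClosed`. -/
noncomputable def speckerSet : V := setOf (fun n => ∀ I, SpeckerClosed I → n ∈ₙ I)

theorem mem_speckerSet {n : V} : n ∈ₙ (speckerSet : V) ↔ ∀ I, SpeckerClosed I → n ∈ₙ I :=
  mem_setOf_of_exists (exists_set₁ (fun n _ => ∀ I, SpeckerClosed I → n ∈ₙ I) (fun _ => 3)
    (.all 4 (.imp (.specker 0 rfl) (.mem 1 0 rfl))) zero) n

theorem speckerClosed_speckerSet : SpeckerClosed (speckerSet : V) :=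
  ⟨fun n hn h => mem_speckerSet.2 fun _ hI => hI.1 n hn h, fun n a m hn ha hm h =>
    mem_speckerSet.2 fun I hI => hI.2 n a m (mem_speckerSet.1 hn I hI) ha hm h⟩

theorem speckerSet_induction {P : V → Prop} (hP : ∃ y : V, ∀ z, z ∈ₙ y ↔ P z)
    (h0 : ∀ n, n ∈ₙ omega → T univ ∈ₙ n → P n)
    (hs : ∀ n a m, n ∈ₙ speckerSet → P n → pow a ∈ₙ n → m ∈ₙ omega → T a ∈ₙ m → P m) {n : V}
    (hn : n ∈ₙ speckerSet) : P n := by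
  obtain ⟨y, hy⟩ := hP
  obtain ⟨I, hI⟩ := exists_set₂ (fun z y S => z ∈ₙ S ∧ z ∈ₙ y) (2 ∷ 3 ∷ 3 ∷ 0)
    (.and (.mem 0 2 rfl) (.mem 0 1 rfl)) y speckerSet
  have h := speckerClosed_speckerSet (V := V)
  refine (hy n).1 ((hI n).1 (mem_speckerSet.1 hn I ⟨fun n hn hU => (hI n).2
    ⟨h.1 n hn hU, (hy n).2 (h0 n hn hU)⟩, fun n a m hn ha hm ham => (hI m).2 ?_⟩)).2
  obtain ⟨hn, hny⟩ := (hI n).1 hn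
  exact ⟨h.2 n a m hn ha hm ham, (hy m).2 (hs n a m hn ((hy n).1 hny) ha hm ham)⟩

theorem speckerSet_sub_omega : Sub (speckerSet : V) omega := fun _ hn =>
  mem_speckerSet.1 hn _ ⟨fun _ hn _ => hn, fun _ _ _ _ _ hm _ => hm⟩

theorem T_ne_univ (a : V) : T a ≠ univ := fun h => by
  obtain ⟨x, _, hx⟩ := (mem_T a empty).1 (h ▸ mem_univ _)
  exact (mem_empty x).1 (hx ▸ (mem_sing x x).2 rfl)

theorem equinum_of_mem {n A B : V} (hn : n ∈ₙ omega) (hA : A ∈ₙ n) (hB : B ∈ₙ n) : Equinum A B :=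
  ⟨n, hn, hA, hB⟩

theorem sub_univ (a : V) : Sub a univ := fun z _ => mem_univ z

/-- Every member of `speckerSet` is the cardinal of some `T a`. A finite universe equinumerous with
`T a` would equal it, but `∅` is not a singleton. -/
theorem univ_not_mem_of_mem_speckerSet {n : V} (hn : n ∈ₙ speckerSet) : ¬ univ ∈ₙ n := fun hU => by
  have : ∃ a, T a ∈ₙ n := speckerSet_induction (P := fun n => ∃ a, T a ∈ₙ n)
    (exists_set₁ (fun n _ => ∃ a, T a ∈ₙ n) (fun _ => 3)
      (.congr (P := fun s => ∃ a b, b = T a ∧ b ∈ₙ s 0) (fun (s : ℕ → V) => by simp)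
        (.ex 1 (.ex 2 (.and (.eq_T 0 1 rfl rfl) (.mem 0 2 rfl))))) zero)
    (fun n _ h => ⟨_, h⟩) (fun _ a _ _ _ _ _ h => ⟨a, h⟩) hn
  obtain ⟨a, ha⟩ := this
  exact T_ne_univ a ((equinum_of_mem (speckerSet_sub_omega n hn) ha hU).eq_of_sub (sub_univ _))

theorem pow_univ : pow univ = (univ : V) :=
  set_ext fun z => ⟨fun _ => mem_univ z, fun _ => mem_pow.2 (sub_univ z)⟩

/-! ### The Specker set in a finite universe -/

section FiniteUniverse

variable (hV : ∀ A : V, Fin A)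
include hV

/-- Since `P(V) = V`, the set `T V` is `T(P(V))`, which is equinumerous with `P(T V)`. -/
theorem equinum_pow_T_univ : Equinum (pow (T univ)) (T (univ : V)) := by
  have h := (equinum_T_pow (A := (univ : V)) hV).symm
  rwa [pow_univ] at h

/-- `T` commutes with the generating step because `T(P(a))` and `P(T a)` are equinumerous. For the
starting cardinal, `|T V| = |P(T V)|` yields `|T(T V)|`. -/
theorem mem_speckerSet_of_tRel {n : V} (hn : n ∈ₙ speckerSet) :
    ∀ n', TRel n n' → n' ∈ₙ speckerSet := by
  have h := speckerClosed_speckerSet (V := V)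
  refine speckerSet_induction (P := fun n => ∀ n', TRel n n' → n' ∈ₙ speckerSet)
    (exists_set₁ (fun n S => ∀ n', TRel n n' → n' ∈ₙ S) (2 ∷ 4 ∷ 0)
      (.all 3 (.imp (.tRel 1 0 rfl rfl) (.mem 0 2 rfl))) speckerSet) ?_ ?_ hn
  · rintro n hn hU n' ⟨_, hn', a, ha, ha'⟩
    refine h.2 (card (T univ)) (T univ) n' (h.1 _ (card_mem_omega (hV _)) (mem_card (hV _))) ?_ hn'
      (((equinum_of_mem hn ha hU).T.mem_iff hn').1 ha')
    exact ((equinum_pow_T_univ hV).mem_iff (card_mem_omega (hV _))).2 (mem_card (hV _))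
  · rintro n a m hn ih ha hm ham m' ⟨_, hm', b, hb, hb'⟩
    have hc := card_mem_omega (hV (T (pow a)))
    have hc' := mem_card (hV (T (pow a)))
    exact h.2 (card (T (pow a))) (T a) m'
      (ih _ ⟨speckerSet_sub_omega n hn, hc, _, ha, hc'⟩) (((equinum_T_pow hV).mem_iff hc).1 hc') hm'
      (((equinum_of_mem hm hb ham).T.mem_iff hm').1 hb')

/-- For `m = |T a|` obtained from `n = |P(a)|`, the preimage under `T` is `|a|`, and the task is to
find it in `speckerSet`. If `n = |T V|`, then `a` has the size of `T V`. If `n = |T c|`, then `a`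
has the size of some `T b`, so that `c` has the size of `P(b)` and the closure rule gives `|T b|`.
-/
theorem exists_tRel_of_mem_speckerSet {n : V} (hn : n ∈ₙ speckerSet) :
    T univ ∈ₙ n ∨ ∃ k, k ∈ₙ speckerSet ∧ TRel k n := by
  have h := speckerClosed_speckerSet (V := V)
  refine speckerSet_induction (P := fun n => T univ ∈ₙ n ∨ ∃ k, k ∈ₙ speckerSet ∧ TRel k n)
    (exists_set₂ (fun n S U => U ∈ₙ n ∨ ∃ k, k ∈ₙ S ∧ TRel k n) (3 ∷ 3 ∷ 2 ∷ 0)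
      (.or (.mem 2 0 rfl) (.ex 2 (.and (.mem 0 2 rfl) (.tRel 0 1 rfl rfl)))) speckerSet (T univ))
    (fun _ _ h => .inl h) ?_ hn
  intro n a m hn ih ha hm ham
  have hc := card_mem_omega (hV a)
  have hn' := speckerSet_sub_omega n hn
  refine .inr ⟨card a, ?_, hc, hm, a, mem_card (hV a), ham⟩
  obtain hU | ⟨k, hk, hk', -, c, hck, hcn⟩ := ih
  · have e : Equinum a (T univ) := Equinum.of_pow hV
      ((equinum_of_mem hn' ha hU).trans (equinum_pow_T_univ hV).symm)
    exact h.1 _ hc ((e.mem_iff hc).1 (mem_card (hV a)))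
  · have e := equinum_of_mem hn' hcn ha
    obtain ⟨B, hB, haB⟩ | ⟨A, hA, hAU⟩ := Equinum.exists_sub_or (B := T univ) (hV a)
    · obtain ⟨b, _, rfl⟩ := exists_eq_T hB
      have e' : Equinum c (pow b) := Equinum.of_T (hV _)
        (e.trans ((haB.pow hV).trans (equinum_T_pow hV).symm))
      exact h.2 k b _ hk ((e'.mem_iff hk').1 hck) hc ((haB.mem_iff hc).1 (mem_card (hV a)))
    -- If a copy of `T V` lay inside `a`, then `P(T V)`, of the size of `T V`, would embed in `T c`.
    -- This forces `c = V`, although `|V|` is excluded.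
    · obtain ⟨B, hB, hAB⟩ := e.symm.exists_sub (pow_sub hA)
      have hBU : B = T univ := Equinum.eq_of_sub
        (hAB.symm.trans ((hAU.pow hV).trans (equinum_pow_T_univ hV)))
        fun z hz => T_sub (sub_univ c) z (hB z hz)
      have : c = univ := (sub_univ c).antisymm
        fun z _ => sing_mem_T.1 (hB _ (hBU ▸ sing_mem_T.2 (mem_univ z)))
      exact (univ_not_mem_of_mem_speckerSet hk (this ▸ hck)).elim

end FiniteUniverse

/-- Specker's theorem: the universe is infinite. -/
theorem not_forall_fin : ¬ ∀ A : V, Fin A := fun hV => by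
  -- `D` is the image `T[S]` of the Specker set.
  obtain ⟨D, hD⟩ := exists_set₁ (fun n S => ∃ k, k ∈ₙ S ∧ TRel k n) (3 ∷ 3 ∷ 0)
    (.ex 2 (.and (.mem 0 2 rfl) (.tRel 0 1 rfl rfl))) (speckerSet : V)
  have hc := card_mem_omega (hV (T univ))
  have hCD : ¬ card (T univ) ∈ₙ D := fun h => by
    obtain ⟨k, hk, hk', -, c, hck, hc'⟩ := (hD _).1 h
    have e := Equinum.of_T (hV c) (equinum_of_mem hc hc' (mem_card (hV _)))
    exact univ_not_mem_of_mem_speckerSet hk ((e.mem_iff hk').1 hck)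
  have hS : speckerSet = adj D (card (T univ)) := by
    ext n
    rw [mem_adj, hD]
    constructor
    · intro hn
      exact (exists_tRel_of_mem_speckerSet hV hn).symm.imp_right fun h =>
        omega_eq_of_mem (speckerSet_sub_omega n hn) hc h (mem_card (hV _))
    · rintro (⟨k, hk, h⟩ | rfl)
      · exact mem_speckerSet_of_tRel hV hk n h
      · exact speckerClosed_speckerSet.1 _ hc (mem_card (hV _))
  -- `{k} ↦ T k`: the singleton compensates for the rise in type caused by `T`.
  have hT : Equinum (T speckerSet) D := by
    refine Equinum.of_bijection (t := 3) (r := 0) (R := fun z n _ => ∃ k, z = sing k ∧ TRel k n)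
      (.ex 2 (.and (.eq_sing 1 0 rfl rfl) (.tRel 0 2 rfl rfl))) (empty : V) (hV _) ?_ ?_ ?_ ?_
    · intro z hz
      obtain ⟨k, hk, rfl⟩ := (mem_T _ _).1 hz
      have hk' := speckerSet_sub_omega k hk
      have : ∃ a, a ∈ₙ k := by
        refine speckerSet_induction (P := fun n => ∃ a, a ∈ₙ n)
          (exists_set₁ (fun n _ => ∃ a, a ∈ₙ n) (fun i => i.casesOn 1 fun _ => 0)
            (.ex 0 (.mem 0 1 rfl)) zero) (fun _ _ h => ⟨_, h⟩) (fun _ _ _ _ _ _ _ h => ⟨_, h⟩) hk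
      obtain ⟨a, ha⟩ := this
      have : TRel k (card (T a)) := ⟨hk', card_mem_omega (hV _), a, ha, mem_card (hV _)⟩
      exact ⟨_, (hD _).2 ⟨k, hk, this⟩, k, rfl, this⟩
    · intro n hn
      obtain ⟨k, hk, h⟩ := (hD n).1 hn
      exact ⟨sing k, sing_mem_T.2 hk, k, rfl, h⟩
    · rintro z n n' ⟨k, rfl, hk, hn, a, ha, han⟩ ⟨k', h, hk', hn', a', ha', han'⟩
      obtain rfl := sing_injective h
      exact omega_eq_of_mem hn hn' han (((equinum_of_mem hk ha ha').T.mem_iff hn').2 han')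
    · rintro z z' n ⟨k, rfl, hk, hn, a, ha, han⟩ ⟨k', rfl, hk', hn', a', ha', han'⟩
      have e := Equinum.of_T (hV a) (equinum_of_mem hn han han')
      rw [omega_eq_of_mem hk hk' ha ((e.mem_iff hk').2 ha')]
  -- `S` has one element more than `D`, while `D` has the parity of `T S` and hence of `S`.
  have h1 := adj_mem_evenSet (hV D) hCD
  rw [← hS, ← hT.mem_evenSet_iff, T_mem_evenSet (hV _)] at h1
  exact iff_not_self h1

/-- A member `u` of `n` is finite, so it is not the universe, and any `v` outside `u` gives a member
of `succ n`. -/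
theorem ne_empty_of_mem_omega {n : V} (hn : n ∈ₙ omega) : n ≠ empty := by
  have hU : ¬ Fin (univ : V) := fun h => not_forall_fin fun A => h.sub (sub_univ A)
  refine omega_induction (P := fun n => n ≠ empty) (exists_set₁ (fun n _ => n ≠ empty) (fun _ => 1)
    (.not (.eq_empty 0 rfl)) zero) ?_ ?_ hn
  · intro h
    exact (mem_empty empty).1 (h ▸ mem_zero.2 rfl)
  · intro n hn ih h
    obtain ⟨u, hu⟩ := exists_mem_of_ne_empty ih
    by_cases hv : ∃ v, ¬ v ∈ₙ u
    · obtain ⟨v, hv⟩ := hv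
      exact (mem_empty _).1 (h ▸ adj_mem_succ hu hv)
    · push Not at hv
      exact hU ⟨n, hn, (sub_univ u).antisymm (fun z _ => hv z) ▸ hu⟩

theorem succ_injOn {n m : V} (hn : n ∈ₙ omega) (hm : m ∈ₙ omega) (h : succ n = succ m) :
    n = m := by
  obtain ⟨w, hw⟩ := exists_mem_of_ne_empty (ne_empty_of_mem_omega (succ_mem_omega hn))
  obtain ⟨u, v, _, _, rfl⟩ := mem_succ_iff.1 hw
  exact omega_eq_of_mem hn hm (del_mem_of_mem_succ hn hw (mem_adj_self u v))
    (del_mem_of_mem_succ hm (h ▸ hw) (mem_adj_self u v))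

end Infinity

/-! ### Ordered pairs -/

section Pairs

variable {V : Type*} [Model V]

/-- Infinity enters the theory of pairs here, through `succ_injOn`. Shifted numbers remain numbers
and non-numbers are fixed, so the two kinds cannot be confused. -/
theorem sub_of_shift_eq {a b : V} (h : shift a = shift b) : Sub a b := fun m hm => by
  by_cases hmω : m ∈ₙ omega
  · have : succ m ∈ₙ shift b := h ▸ (mem_shift _ _).2 (.inl ⟨m, hm, hmω, rfl⟩)
    obtain ⟨n, hn, hnω, e⟩ | ⟨_, h'⟩ := (mem_shift _ _).1 this
    · exact succ_injOn hmω hnω e ▸ hn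
    · exact (h' (succ_mem_omega hmω)).elim
  · have : m ∈ₙ shift b := h ▸ (mem_shift _ _).2 (.inr ⟨hm, hmω⟩)
    obtain ⟨n, hn, hnω, rfl⟩ | ⟨h', _⟩ := (mem_shift _ _).1 this
    · exact (hmω (succ_mem_omega hnω)).elim
    · exact h'

theorem shift_injective {a b : V} (h : shift a = shift b) : a = b :=
  (sub_of_shift_eq h).antisymm (sub_of_shift_eq h.symm)

theorem zero_not_mem_shift (a : V) : ¬ zero ∈ₙ shift a := fun h => by
  obtain ⟨n, _, _, e⟩ | ⟨_, h⟩ := (mem_shift _ _).1 h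
  exacts [zero_ne_succ n e, h zero_mem_omega]

theorem mem_pair_iff {x y p : V} : p ∈ₙ pair x y ↔
    (∃ a, a ∈ₙ x ∧ p = shift a) ∨ ∃ b, b ∈ₙ y ∧ p = adj (shift b) zero := by
  simp only [mem_pair, ext_iff (y := adj _ _), mem_adj]

theorem shift_mem_pair {x y a : V} : shift a ∈ₙ pair x y ↔ a ∈ₙ x := by
  rw [mem_pair_iff]
  constructor
  · rintro (⟨b, hb, e⟩ | ⟨b, _, e⟩)
    · exact shift_injective e ▸ hb
    · exact (zero_not_mem_shift a (e ▸ mem_adj_self _ _)).elim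
  · exact fun h => .inl ⟨a, h, rfl⟩

theorem adj_shift_mem_pair {x y b : V} : adj (shift b) zero ∈ₙ pair x y ↔ b ∈ₙ y := by
  rw [mem_pair_iff]
  constructor
  · rintro (⟨a, _, e⟩ | ⟨c, hc, e⟩)
    · exact (zero_not_mem_shift a (e ▸ mem_adj_self _ _)).elim
    · have := congrArg (del · zero) e
      simp only [del_adj (zero_not_mem_shift _)] at this
      exact shift_injective this ▸ hc
  · exact fun h => .inr ⟨b, h, rfl⟩

theorem pair_inj {x y x' y' : V} : pair x y = pair x' y' ↔ x = x' ∧ y = y' := by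
  refine ⟨fun h => ⟨set_ext fun a => ?_, set_ext fun b => ?_⟩, fun ⟨h, h'⟩ => h ▸ h' ▸ rfl⟩
  · rw [← shift_mem_pair (y := y), h, shift_mem_pair]
  · rw [← adj_shift_mem_pair (x := x), h, adj_shift_mem_pair]

theorem Definable.eq_shift {Γ : ℕ → ℕ} {t : ℕ} (i j : ℕ) (hi : Γ i = t + 3) (hj : Γ j = t + 3) :
    Definable Γ (fun s : ℕ → V => s i = shift (s j)) :=
  .congr (fun s => by rw [ext_iff]; simp only [mem_shift]) <|
    .all (t + 2) (P := fun s m => m ∈ₙ s i ↔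
        (∃ n, n ∈ₙ s j ∧ n ∈ₙ omega ∧ m = succ n) ∨ (m ∈ₙ s j ∧ ¬ m ∈ₙ omega))
      (.iff (.mem 0 (i + 1) hi.symm) (.or (.ex (t + 2) (.and (.mem 0 (j + 2) hj.symm)
        (.and (.mem_omega 0 rfl) (.eq_succ 1 0 rfl rfl))))
        (.and (.mem 0 (j + 1) hj.symm) (.not (.mem_omega 0 rfl)))))

/-- The pair has the type of its components. The offset 4 leaves room for the elements of the
components, the numbers inside those, and two levels for the definition of `succ`. -/
theorem Definable.eq_pair {Γ : ℕ → ℕ} {t : ℕ} (i j k : ℕ) (hi : Γ i = t + 4) (hj : Γ j = t + 4)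
    (hk : Γ k = t + 4) : Definable Γ (fun s : ℕ → V => s i = pair (s j) (s k)) :=
  .congr (P := fun s => ∀ p, p ∈ₙ s i ↔ (∃ a, a ∈ₙ s j ∧ p = shift a) ∨
      ∃ b, b ∈ₙ s k ∧ ∃ c z, c = shift b ∧ z = zero ∧ p = adj c z)
    (fun s => by rw [ext_iff (x := s i)]; simp [mem_pair_iff]) <|
    .all (t + 3) (.iff (.mem 0 (i + 1) hi.symm) (.or (.ex (t + 3) (.and (.mem 0 (j + 2) hj.symm)
        (.eq_shift 1 0 rfl rfl)))
      (.ex (t + 3) (.and (.mem 0 (k + 2) hk.symm) (.ex (t + 3) (.ex (t + 2)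
        (.and (.eq_shift 1 2 rfl rfl) (.and (.eq_zero 0 rfl) (.eq_adj 3 1 0 rfl rfl rfl)))))))))

theorem Definable.pair_mem {Γ : ℕ → ℕ} {t : ℕ} (i j k : ℕ) (hi : Γ i = t + 4) (hj : Γ j = t + 4)
    (hk : Γ k = t + 5) : Definable Γ (fun s : ℕ → V => pair (s i) (s j) ∈ₙ s k) :=
  .congr (P := fun s => ∃ p, p = pair (s i) (s j) ∧ p ∈ₙ s k) (fun s => by simp) <|
    .ex (t + 4) (.and (.eq_pair 0 (i + 1) (j + 1) rfl hi hj) (.mem 0 (k + 1) hk.symm))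

end Pairs

/-! ### Functions of the model -/

section Functions

variable {V : Type*} [Model V]

namespace IsFun

variable {f g A B B' x y : V}

theorem mem_of_pair_mem (hf : IsFun f A B) (h : pair x y ∈ₙ f) : x ∈ₙ A ∧ y ∈ₙ B := by
  obtain ⟨x', y', hx, hy, e⟩ := hf.1 _ h
  obtain ⟨rfl, rfl⟩ := pair_inj.1 e
  exact ⟨hx, hy⟩

theorem pair_ap_mem (hf : IsFun f A B) (hx : x ∈ₙ A) : pair x (ap f x) ∈ₙ f :=
  Classical.epsilon_spec (hf.2 x hx).exists

theorem ap_eq (hf : IsFun f A B) (h : pair x y ∈ₙ f) : ap f x = y :=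
  (hf.2 x (hf.mem_of_pair_mem h).1).unique (hf.pair_ap_mem (hf.mem_of_pair_mem h).1) h

theorem ap_mem (hf : IsFun f A B) (hx : x ∈ₙ A) : ap f x ∈ₙ B :=
  (hf.mem_of_pair_mem (hf.pair_ap_mem hx)).2

theorem pair_mem_iff (hf : IsFun f A B) : pair x y ∈ₙ f ↔ x ∈ₙ A ∧ ap f x = y :=
  ⟨fun h => ⟨(hf.mem_of_pair_mem h).1, hf.ap_eq h⟩, fun ⟨hx, h⟩ => h ▸ hf.pair_ap_mem hx⟩

theorem mem_iff (hf : IsFun f A B) {q : V} : q ∈ₙ f ↔ ∃ x, x ∈ₙ A ∧ q = pair x (ap f x) := by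
  refine ⟨fun h => ?_, fun ⟨x, hx, e⟩ => e ▸ hf.pair_ap_mem hx⟩
  obtain ⟨x, y, hx, _, rfl⟩ := hf.1 _ h
  exact ⟨x, hx, by rw [hf.ap_eq h]⟩

theorem ext (hf : IsFun f A B) (hg : IsFun g A B') (h : ∀ x, x ∈ₙ A → ap f x = ap g x) : f = g :=
  set_ext fun q => by
    rw [hf.mem_iff, hg.mem_iff]
    exact exists_congr fun x => and_congr_right fun hx => by rw [h x hx]

theorem of_graph {φ : V → V} (hf : ∀ q, q ∈ₙ f ↔ ∃ x, x ∈ₙ A ∧ q = pair x (φ x))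
    (hφ : ∀ x, x ∈ₙ A → φ x ∈ₙ B) : IsFun f A B := by
  refine ⟨fun q hq => ?_, fun x hx => ⟨φ x, (hf _).2 ⟨x, hx, rfl⟩, fun y hy => ?_⟩⟩
  · obtain ⟨x, hx, rfl⟩ := (hf q).1 hq
    exact ⟨x, φ x, hx, hφ x hx, rfl⟩
  · obtain ⟨x', _, e⟩ := (hf _).1 hy
    obtain ⟨rfl, rfl⟩ := pair_inj.1 e
    rfl

theorem ap_of_graph {φ : V → V} (hf : ∀ q, q ∈ₙ f ↔ ∃ x, x ∈ₙ A ∧ q = pair x (φ x))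
    (hφ : ∀ x, x ∈ₙ A → φ x ∈ₙ B) (hx : x ∈ₙ A) : ap f x = φ x :=
  (of_graph hf hφ).ap_eq ((hf _).2 ⟨x, hx, rfl⟩)

theorem isBij (hf : IsFun f A B) (hi : ∀ x x', x ∈ₙ A → x' ∈ₙ A → ap f x = ap f x' → x = x')
    (hs : ∀ y, y ∈ₙ B → ∃ x, x ∈ₙ A ∧ ap f x = y) : IsBij f A B :=
  ⟨hf, fun y hy => by
    obtain ⟨x, hx, rfl⟩ := hs y hy
    exact ⟨x, ⟨hx, hf.pair_ap_mem hx⟩, fun x' hx' => hi _ _ hx'.1 hx (hf.ap_eq hx'.2)⟩⟩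

end IsFun

theorem Definable.isFun {Γ : ℕ → ℕ} {t : ℕ} (i j k : ℕ) (hi : Γ i = t + 5) (hj : Γ j = t + 5)
    (hk : Γ k = t + 5) : Definable Γ (fun s : ℕ → V => IsFun (s i) (s j) (s k)) :=
  .and (.all (t + 4) (.imp (.mem 0 (i + 1) hi.symm) (.ex (t + 4) (.ex (t + 4)
      (.and (.mem 1 (j + 3) hj.symm) (.and (.mem 0 (k + 3) hk.symm) (.eq_pair 2 1 0 rfl rfl rfl)))))))
    (.all (t + 4) (.imp (.mem 0 (j + 1) hj.symm) (.ex (t + 4)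
      (.and (.pair_mem 1 0 (i + 2) rfl rfl hi)
        (.all (t + 4) (.imp (.pair_mem 2 0 (i + 3) rfl rfl hi) (.eq 0 1 rfl)))))))

theorem mem_funSet {A B f : V} : f ∈ₙ funSet A B ↔ IsFun f A B :=
  mem_setOf_of_exists (exists_set₂ IsFun (fun _ => 5) (.isFun 0 1 2 rfl rfl rfl) A B) f

theorem pair_mem_fibProd {A B C f g x y : V} (hf : IsFun f A C) (hg : IsFun g B C) :
    pair x y ∈ₙ fibProd A B f g ↔ x ∈ₙ A ∧ y ∈ₙ B ∧ ap f x = ap g y := by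
  rw [mem_fibProd]
  constructor
  · rintro ⟨x', y', c, hx, hy, hc, hc', e⟩
    obtain ⟨rfl, rfl⟩ := pair_inj.1 e
    exact ⟨hx, hy, (hf.ap_eq hc).trans (hg.ap_eq hc').symm⟩
  · rintro ⟨hx, hy, e⟩
    exact ⟨x, y, ap f x, hx, hy, hf.pair_ap_mem hx, e ▸ hg.pair_ap_mem hy, rfl⟩

theorem exists_pair_of_mem_fibProd {A B f g p : V} (h : p ∈ₙ fibProd A B f g) :
    ∃ x y, p = pair x y := by
  obtain ⟨x, y, _, _, _, _, _, e⟩ := (mem_fibProd _ _ _ _ _).1 h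
  exact ⟨x, y, e⟩

theorem mem_one {x : V} : x ∈ₙ (one : V) ↔ x = empty := mem_sing _ _

theorem mem_point {a q : V} : q ∈ₙ point a ↔ ∃ x, x ∈ₙ (one : V) ∧ q = pair x a := by
  simp [point, mem_sing, mem_one]

theorem isFun_point {a A : V} (ha : a ∈ₙ A) : IsFun (point a) one A :=
  .of_graph (φ := fun _ => a) (fun _ => mem_point) fun _ _ => ha

theorem ap_point (a : V) : ap (point a) empty = a :=
  IsFun.ap_of_graph (φ := fun _ => a) (fun _ => mem_point) (fun _ _ => mem_univ a) (mem_one.2 rfl)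

theorem IsFun.eq_point {p A : V} (hp : IsFun p one A) : p = point (ap p empty) :=
  hp.ext (isFun_point (hp.ap_mem (mem_one.2 rfl))) fun x hx => by
    rw [mem_one.1 hx, ap_point]

theorem SameSize.symm {A B : V} : SameSize A B → SameSize B A := by
  rintro ⟨f, hf, hb⟩
  obtain ⟨g, hg⟩ := exists_set₁ (fun q f => ∃ x y, pair x y ∈ₙ f ∧ q = pair y x) (4 ∷ 5 ∷ 0)
    (.ex 4 (.ex 4 (.and (.pair_mem 1 0 3 rfl rfl rfl) (.eq_pair 2 0 1 rfl rfl rfl)))) f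
  have hgp : ∀ x y, pair y x ∈ₙ g ↔ pair x y ∈ₙ f := fun x y => by
    rw [hg]
    refine ⟨fun ⟨x', y', h, e⟩ => ?_, fun h => ⟨x, y, h, rfl⟩⟩
    obtain ⟨rfl, rfl⟩ := pair_inj.1 e
    exact h
  refine ⟨g, ⟨fun q hq => ?_, fun y hy => ?_⟩, fun x hx => ?_⟩
  · obtain ⟨x, y, h, rfl⟩ := (hg q).1 hq
    exact ⟨y, x, (hf.mem_of_pair_mem h).2, (hf.mem_of_pair_mem h).1, rfl⟩
  · obtain ⟨x, ⟨_, hx⟩, hu⟩ := hb y hy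
    exact ⟨x, (hgp _ _).2 hx, fun x' h => hu x' ⟨(hf.mem_of_pair_mem ((hgp _ _).1 h)).1,
      (hgp _ _).1 h⟩⟩
  · exact ⟨ap f x, ⟨hf.ap_mem hx, (hgp _ _).2 (hf.pair_ap_mem hx)⟩,
      fun y hy => (hf.ap_eq ((hgp _ _).1 hy.2)).symm⟩

theorem SameSize.trans {A B C : V} : SameSize A B → SameSize B C → SameSize A C := by
  rintro ⟨f, hf, hfb⟩ ⟨g, hg, hgb⟩
  obtain ⟨h, hh⟩ := exists_set₂ (fun q f g => ∃ x y z, pair x y ∈ₙ f ∧ pair y z ∈ₙ g ∧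
    q = pair x z) (4 ∷ 5 ∷ 5 ∷ 0) (.ex 4 (.ex 4 (.ex 4 (.and (.pair_mem 2 1 4 rfl rfl rfl)
      (.and (.pair_mem 1 0 5 rfl rfl rfl) (.eq_pair 3 2 0 rfl rfl rfl)))))) f g
  have hq : ∀ q, q ∈ₙ h ↔ ∃ x, x ∈ₙ A ∧ q = pair x (ap g (ap f x)) := fun q => by
    rw [hh]
    constructor
    · rintro ⟨x, y, z, hx, hy, rfl⟩
      exact ⟨x, (hf.mem_of_pair_mem hx).1, by rw [hf.ap_eq hx, hg.ap_eq hy]⟩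
    · rintro ⟨x, hx, rfl⟩
      exact ⟨x, _, _, hf.pair_ap_mem hx, hg.pair_ap_mem (hf.ap_mem hx), rfl⟩
  have hm : ∀ x, x ∈ₙ A → ap g (ap f x) ∈ₙ C := fun x hx => hg.ap_mem (hf.ap_mem hx)
  refine ⟨h, IsFun.isBij (.of_graph hq hm) (fun x x' hx hx' e => ?_) fun z hz => ?_⟩
  · rw [IsFun.ap_of_graph hq hm hx, IsFun.ap_of_graph hq hm hx'] at e
    have e' := (hgb _ (hm x hx)).unique ⟨hf.ap_mem hx, hg.pair_ap_mem (hf.ap_mem hx)⟩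
      ⟨hf.ap_mem hx', e ▸ hg.pair_ap_mem (hf.ap_mem hx')⟩
    exact (hfb _ (hf.ap_mem hx)).unique ⟨hx, hf.pair_ap_mem hx⟩ ⟨hx', e' ▸ hf.pair_ap_mem hx'⟩
  · obtain ⟨y, ⟨hy, hyz⟩, _⟩ := hgb z hz
    obtain ⟨x, ⟨hx, hxy⟩, _⟩ := hfb y hy
    exact ⟨x, hx, by rw [IsFun.ap_of_graph hq hm hx, hf.ap_eq hxy, hg.ap_eq hyz]⟩

/-- The bijection `p ↦ {p(∅)}` from `N(1, A)` onto `T(A)`. -/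
theorem exists_isBij_funSet_T (A : V) : ∃ t : V, IsBij t (funSet one A) (T A) ∧
    ∀ p : V, IsFun p one A → ap t p = sing (ap p empty) := by
  -- With `x` of type 4, both `{⟨∅, x⟩}` and `{x}` have type 5, so they can be paired.
  obtain ⟨t, ht⟩ := exists_set₁ (fun q A => ∃ x e r p s, x ∈ₙ A ∧ e = empty ∧ r = pair e x ∧
      p = sing r ∧ s = sing x ∧ q = pair p s) (5 ∷ 5 ∷ 0)
    (.ex 4 (.ex 4 (.ex 4 (.ex 5 (.ex 5 (.and (.mem 4 6 rfl) (.and (.eq_empty 3 rfl)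
      (.and (.eq_pair 2 3 4 rfl rfl rfl) (.and (.eq_sing 1 2 rfl rfl) (.and (.eq_sing 0 4 rfl rfl)
        (.eq_pair 5 1 0 rfl rfl rfl))))))))))) A
  have hq : ∀ q, q ∈ₙ t ↔ ∃ p, p ∈ₙ funSet one A ∧ q = pair p (sing (ap p empty)) := fun q => by
    rw [ht]
    constructor
    · rintro ⟨x, _, _, _, _, hx, rfl, rfl, rfl, rfl, rfl⟩
      exact ⟨point x, mem_funSet.2 (isFun_point hx), by rw [ap_point]; rfl⟩
    · rintro ⟨p, hp, rfl⟩
      have hp := mem_funSet.1 hp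
      exact ⟨ap p empty, _, _, _, _, hp.ap_mem (mem_one.2 rfl), rfl, rfl, rfl, rfl,
        congrArg (pair · _) hp.eq_point⟩
  have hm : ∀ p, p ∈ₙ funSet one A → sing (ap p empty) ∈ₙ T A := fun p hp =>
    sing_mem_T.2 ((mem_funSet.1 hp).ap_mem (mem_one.2 rfl))
  refine ⟨t, IsFun.isBij (.of_graph hq hm) (fun p p' hp hp' e => ?_) fun z hz => ?_,
    fun p hp => IsFun.ap_of_graph hq hm (mem_funSet.2 hp)⟩
  · rw [IsFun.ap_of_graph hq hm hp, IsFun.ap_of_graph hq hm hp'] at e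
    rw [(mem_funSet.1 hp).eq_point, sing_injective e, ← (mem_funSet.1 hp').eq_point]
  · obtain ⟨x, hx, rfl⟩ := (mem_T _ _).1 hz
    have hp := mem_funSet.2 (isFun_point hx)
    exact ⟨point x, hp, by rw [IsFun.ap_of_graph hq hm hp, ap_point]⟩

end Functions

/-! ### Internal diagrams -/

section Diagram

variable {V : Type*} [Model V] (C : InternalCategory V)

theorem InternalCategory.pair_mem_arrows {f g : V} :
    pair f g ∈ₙ fibProd C.C₁ C.C₁ C.d₁ C.d₀ ↔ f ∈ₙ C.C₁ ∧ g ∈ₙ C.C₁ ∧ ap C.d₁ f = ap C.d₀ g :=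
  pair_mem_fibProd C.d₁_fun C.d₀_fun

theorem mem_R_γ₀ {X γ q : V} : q ∈ₙ (R C X γ).γ₀ ↔
    ∃ x f c, pair x f ∈ₙ fibProd X C.C₁ γ C.d₀ ∧ pair f c ∈ₙ C.d₁ ∧ q = pair (pair x f) c :=
  mem_setOf_of_exists (exists_set₂ (fun q P d => ∃ x f c, pair x f ∈ₙ P ∧ pair f c ∈ₙ d ∧
    q = pair (pair x f) c) (4 ∷ 5 ∷ 5 ∷ 0)
    (.congr (P := fun s => ∃ x f c, pair x f ∈ₙ s 1 ∧ pair f c ∈ₙ s 2 ∧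
      ∃ p, p = pair x f ∧ s 0 = pair p c) (fun (s : ℕ → V) => by simp)
      (.ex 4 (.ex 4 (.ex 4 (.and (.pair_mem 2 1 4 rfl rfl rfl) (.and (.pair_mem 1 0 5 rfl rfl rfl)
        (.ex 4 (.and (.eq_pair 0 3 2 rfl rfl rfl) (.eq_pair 4 0 1 rfl rfl rfl)))))))))
    (fibProd X C.C₁ γ C.d₀) C.d₁) q

theorem mem_R_e {X γ q : V} : q ∈ₙ (R C X γ).e ↔
    ∃ x f g h, pair x f ∈ₙ fibProd X C.C₁ γ C.d₀ ∧ pair (pair f g) h ∈ₙ C.m ∧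
      q = pair (pair (pair x f) g) (pair x h) :=
  mem_setOf_of_exists (exists_set₂ (fun q P m => ∃ x f g h, pair x f ∈ₙ P ∧
    pair (pair f g) h ∈ₙ m ∧ q = pair (pair (pair x f) g) (pair x h)) (4 ∷ 5 ∷ 5 ∷ 0)
    (.congr (P := fun s => ∃ x f g h, pair x f ∈ₙ s 1 ∧ ∃ p r k l, p = pair f g ∧
      r = pair x f ∧ k = pair r g ∧ l = pair x h ∧ pair p h ∈ₙ s 2 ∧ s 0 = pair k l)
      (fun (s : ℕ → V) => by simp)
      (.ex 4 (.ex 4 (.ex 4 (.ex 4 (.and (.pair_mem 3 2 5 rfl rfl rfl) (.ex 4 (.ex 4 (.ex 4 (.ex 4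
        (.and (.eq_pair 3 6 5 rfl rfl rfl) (.and (.eq_pair 2 7 6 rfl rfl rfl)
        (.and (.eq_pair 1 2 5 rfl rfl rfl) (.and (.eq_pair 0 7 4 rfl rfl rfl)
        (.and (.pair_mem 3 4 10 rfl rfl rfl) (.eq_pair 8 1 0 rfl rfl rfl))))))))))))))))
    (fibProd X C.C₁ γ C.d₀) C.m) q

variable {C} {X γ : V}

section
variable (hγ : IsFun γ X C.C₀)
include hγ

theorem isFun_R_γ₀ : IsFun (R C X γ).γ₀ (R C X γ).F₀ C.C₀ := by
  refine ⟨fun q hq => ?_, fun p hp => ?_⟩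
  · obtain ⟨x, f, c, hp, hc, rfl⟩ := (mem_R_γ₀ C).1 hq
    exact ⟨_, _, hp, (C.d₁_fun.mem_of_pair_mem hc).2, rfl⟩
  · obtain ⟨x, f, rfl⟩ := exists_pair_of_mem_fibProd hp
    have hf := ((pair_mem_fibProd hγ C.d₀_fun).1 hp).2.1
    refine ⟨ap C.d₁ f, (mem_R_γ₀ C).2 ⟨x, f, _, hp, C.d₁_fun.pair_ap_mem hf, rfl⟩,
      fun c hc => ?_⟩
    obtain ⟨x', f', c', _, h, e⟩ := (mem_R_γ₀ C).1 hc
    simp only [pair_inj] at e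
    obtain ⟨⟨rfl, rfl⟩, rfl⟩ := e
    exact (C.d₁_fun.ap_eq h).symm

theorem ap_R_γ₀ {x f : V} (h : pair x f ∈ₙ (R C X γ).F₀) :
    ap (R C X γ).γ₀ (pair x f) = ap C.d₁ f :=
  (isFun_R_γ₀ hγ).ap_eq ((mem_R_γ₀ C).2
    ⟨x, f, _, h, C.d₁_fun.pair_ap_mem ((pair_mem_fibProd hγ C.d₀_fun).1 h).2.1, rfl⟩)

theorem pair_comp_mem_R {x f g : V} (h : pair x f ∈ₙ (R C X γ).F₀) (hg : g ∈ₙ C.C₁)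
    (hfg : ap C.d₁ f = ap C.d₀ g) : pair x (ap C.m (pair f g)) ∈ₙ (R C X γ).F₀ := by
  obtain ⟨hx, hf, e⟩ := (pair_mem_fibProd hγ C.d₀_fun).1 h
  exact (pair_mem_fibProd hγ C.d₀_fun).2
    ⟨hx, C.m_fun.ap_mem (C.pair_mem_arrows.2 ⟨hf, hg, hfg⟩), by rw [C.d₀_m f g hf hg hfg, e]⟩

theorem isFun_R_e :
    IsFun (R C X γ).e (fibProd (R C X γ).F₀ C.C₁ (R C X γ).γ₀ C.d₀) (R C X γ).F₀ := by
  have hR := isFun_R_γ₀ hγ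
  refine ⟨fun q hq => ?_, fun p hp => ?_⟩
  · obtain ⟨x, f, g, h, hp, hm, rfl⟩ := (mem_R_e C).1 hq
    obtain ⟨hf, hg, hfg⟩ := C.pair_mem_arrows.1 (C.m_fun.mem_of_pair_mem hm).1
    refine ⟨_, _, (pair_mem_fibProd hR C.d₀_fun).2 ⟨hp, hg, by rw [ap_R_γ₀ hγ hp, hfg]⟩, ?_, rfl⟩
    exact C.m_fun.ap_eq hm ▸ pair_comp_mem_R hγ hp hg hfg
  · obtain ⟨w, g, rfl⟩ := exists_pair_of_mem_fibProd hp
    obtain ⟨hw, hg, hwg⟩ := (pair_mem_fibProd hR C.d₀_fun).1 hp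
    obtain ⟨x, f, rfl⟩ := exists_pair_of_mem_fibProd hw
    rw [ap_R_γ₀ hγ hw] at hwg
    have hf := ((pair_mem_fibProd hγ C.d₀_fun).1 hw).2.1
    refine ⟨pair x (ap C.m (pair f g)), (mem_R_e C).2 ⟨x, f, g, _, hw,
      C.m_fun.pair_ap_mem (C.pair_mem_arrows.2 ⟨hf, hg, hwg⟩), rfl⟩, fun y hy => ?_⟩
    obtain ⟨x', f', g', h', _, hm, e⟩ := (mem_R_e C).1 hy
    simp only [pair_inj] at e
    obtain ⟨⟨⟨rfl, rfl⟩, rfl⟩, rfl⟩ := e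
    rw [C.m_fun.ap_eq hm]

theorem ap_R_e {x f g : V} (h : pair x f ∈ₙ (R C X γ).F₀) (hg : g ∈ₙ C.C₁)
    (hfg : ap C.d₁ f = ap C.d₀ g) :
    ap (R C X γ).e (pair (pair x f) g) = pair x (ap C.m (pair f g)) :=
  (isFun_R_e hγ).ap_eq ((mem_R_e C).2 ⟨x, f, g, _, h, C.m_fun.pair_ap_mem
    (C.pair_mem_arrows.2 ⟨((pair_mem_fibProd hγ C.d₀_fun).1 h).2.1, hg, hfg⟩), rfl⟩)

/-- The diagram freely generated by a function into the set of objects is a diagram. -/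
theorem isDiagram_R : IsDiagram C (R C X γ) where
  γ₀_fun := isFun_R_γ₀ hγ
  e_fun := isFun_R_e hγ
  γ₀_e w g hw hg e := by
    obtain ⟨x, f, rfl⟩ := exists_pair_of_mem_fibProd hw
    have hf := ((pair_mem_fibProd hγ C.d₀_fun).1 hw).2.1
    rw [ap_R_γ₀ hγ hw] at e
    rw [ap_R_e hγ hw hg e, ap_R_γ₀ hγ (pair_comp_mem_R hγ hw hg e), C.d₁_m f g hf hg e]
  e_id w hw := by
    obtain ⟨x, f, rfl⟩ := exists_pair_of_mem_fibProd hw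
    have hf := ((pair_mem_fibProd hγ C.d₀_fun).1 hw).2.1
    have hc := C.d₁_fun.ap_mem hf
    rw [ap_R_γ₀ hγ hw, ap_R_e hγ hw (C.i_fun.ap_mem hc) (C.d₀_i _ hc).symm, C.m_id f hf]
  e_m w g h hw hg hh e e' := by
    obtain ⟨x, f, rfl⟩ := exists_pair_of_mem_fibProd hw
    have hf := ((pair_mem_fibProd hγ C.d₀_fun).1 hw).2.1
    rw [ap_R_γ₀ hγ hw] at e
    rw [ap_R_e hγ hw hg e, ap_R_e hγ (pair_comp_mem_R hγ hw hg e) hh (by rwa [C.d₁_m f g hf hg e]),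
      ap_R_e hγ hw (C.m_fun.ap_mem (C.pair_mem_arrows.2 ⟨hg, hh, e'⟩))
        (by rwa [C.d₀_m g h hg hh e']), C.assoc f g h hf hg hh e e']

end

theorem IsDiagram.pair_mem_iff {F : DiagramData V} (hF : IsDiagram C F) {x f : V} :
    pair x f ∈ₙ fibProd F.F₀ C.C₁ F.γ₀ C.d₀ ↔ x ∈ₙ F.F₀ ∧ f ∈ₙ C.C₁ ∧ ap F.γ₀ x = ap C.d₀ f :=
  pair_mem_fibProd hF.γ₀_fun C.d₀_fun

/-- `ap` is a choice operator and not part of the formal language, so naturality is restated through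
membership of pairs in graphs. The restatement is equivalent because the structure maps of both
diagrams are functions. -/
theorem mem_natSet {F G : DiagramData V} (hF : IsDiagram C F) (hG : IsDiagram C G) {α : V} :
    α ∈ₙ natSet C F G ↔ IsNat C F G α := by
  refine mem_setOf_of_exists (P := fun α => IsNat C F G α) ?_ α
  have hD : Definable (fun _ => 5) (fun s : ℕ → V => IsFun (s 0) (s 1) (s 2) ∧
      (∀ x z c, pair x z ∈ₙ s 0 → pair x c ∈ₙ s 3 → pair z c ∈ₙ s 4) ∧
      ∀ x f y z w p r, pair x z ∈ₙ s 0 → p = pair x f → r = pair z f → pair p y ∈ₙ s 5 →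
        pair y w ∈ₙ s 0 → pair r w ∈ₙ s 6) :=
    .and (.isFun 0 1 2 rfl rfl rfl) (.and
      (.all 4 (.all 4 (.all 4 (.imp (.pair_mem 2 1 3 rfl rfl rfl)
        (.imp (.pair_mem 2 0 6 rfl rfl rfl) (.pair_mem 1 0 7 rfl rfl rfl))))))
      (.all 4 (.all 4 (.all 4 (.all 4 (.all 4 (.all 4 (.all 4
        (.imp (.pair_mem 6 3 7 rfl rfl rfl) (.imp (.eq_pair 1 6 5 rfl rfl rfl)
        (.imp (.eq_pair 0 3 5 rfl rfl rfl) (.imp (.pair_mem 1 4 12 rfl rfl rfl)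
        (.imp (.pair_mem 4 2 7 rfl rfl rfl) (.pair_mem 0 2 13 rfl rfl rfl))))))))))))))
  obtain ⟨N, hN⟩ := hD.exists_set (F.F₀ ∷ G.F₀ ∷ F.γ₀ ∷ G.γ₀ ∷ F.e ∷ fun _ => G.e)
  refine ⟨N, fun α => (hN α).trans (and_congr_right fun (hα : IsFun α F.F₀ G.F₀) =>
    (and_congr_left' ?_).trans (and_congr_right fun hγ => ?_))⟩
  · change (∀ x z c, pair x z ∈ₙ α → pair x c ∈ₙ F.γ₀ → pair z c ∈ₙ G.γ₀) ↔ _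
    constructor
    · exact fun h x hx => hG.γ₀_fun.ap_eq
        (h x _ _ (hα.pair_ap_mem hx) (hF.γ₀_fun.pair_ap_mem hx))
    · intro h x z c hz hc
      obtain ⟨hx, rfl⟩ := hα.pair_mem_iff.1 hz
      rw [← hF.γ₀_fun.ap_eq hc, ← h x hx]
      exact hG.γ₀_fun.pair_ap_mem (hα.ap_mem hx)
  · change (∀ x f y z w p r, pair x z ∈ₙ α → p = pair x f → r = pair z f → pair p y ∈ₙ F.e →
        pair y w ∈ₙ α → pair r w ∈ₙ G.e) ↔ _
    constructor
    · intro h x f hx hf e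
      have hy := hF.e_fun.pair_ap_mem (hF.pair_mem_iff.2 ⟨hx, hf, e⟩)
      exact (hG.e_fun.ap_eq (h x f _ _ _ _ _ (hα.pair_ap_mem hx) rfl rfl hy
        (hα.pair_ap_mem (hF.e_fun.mem_of_pair_mem hy).2))).symm
    · rintro h x f y z w _ _ hz rfl rfl hy hw
      obtain ⟨hx, hf, e⟩ := hF.pair_mem_iff.1 (hF.e_fun.mem_of_pair_mem hy).1
      obtain ⟨-, rfl⟩ := hα.pair_mem_iff.1 hz
      rw [← hα.ap_eq hw, ← hF.e_fun.ap_eq hy, h x f hx hf e]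
      exact hG.e_fun.pair_ap_mem (hG.pair_mem_iff.2 ⟨hα.ap_mem hx, hf, by rw [hγ x hx, e]⟩)

/-- Natural transformations from a representable diagram are determined by the value at the
identity. -/
theorem IsNat.ap_eq {F : DiagramData V} {U α f : V} (hU : U ∈ₙ C.C₀)
    (hα : IsNat C (representable C U) F α) (hf : f ∈ₙ C.C₁) (hfU : ap C.d₀ f = U) :
    ap α (pair empty f) = ap F.e (pair (ap α (pair empty (ap C.i U))) f) := by
  have hu : IsFun (point U) one C.C₀ := isFun_point hU
  have hi := C.i_fun.ap_mem hU
  have h1 : pair empty (ap C.i U) ∈ₙ (representable C U).F₀ :=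
    (pair_mem_fibProd hu C.d₀_fun).2 ⟨mem_one.2 rfl, hi, by rw [ap_point, C.d₀_i U hU]⟩
  have h2 : ap C.d₁ (ap C.i U) = ap C.d₀ f := by rw [C.d₁_i U hU, hfU]
  have h := hα.2.2 _ f h1 hf ((ap_R_γ₀ hu h1).trans h2)
  have h3 := C.id_m f hf
  rw [hfU] at h3
  rwa [representable, ap_R_e hu h1 hf h2, h3] at h

end Diagram

/-! ### The Yoneda lemma -/

section Yoneda

variable {V : Type*} [Model V] {C : InternalCategory V} {U : V} {F : DiagramData V}

theorem pair_mem_representable (hU : U ∈ₙ C.C₀) {f : V} :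
    pair empty f ∈ₙ (representable C U).F₀ ↔ f ∈ₙ C.C₁ ∧ ap C.d₀ f = U := by
  rw [representable, R, pair_mem_fibProd (isFun_point hU) C.d₀_fun, ap_point, mem_one]
  simp [eq_comm]

theorem exists_of_mem_representable {w : V} (h : w ∈ₙ (representable C U).F₀) :
    ∃ f, w = pair empty f := by
  obtain ⟨x, f, _, hx, _, _, _, rfl⟩ := (mem_fibProd _ _ _ _ _).1 h
  exact ⟨f, by rw [mem_one.1 hx]⟩

theorem IsDiagram.mem_fibre (hF : IsDiagram C F) {x : V} :
    x ∈ₙ F.fibre U ↔ x ∈ₙ F.F₀ ∧ ap F.γ₀ x = U := by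
  rw [NF.mem_fibre, hF.γ₀_fun.pair_mem_iff, and_self_left]

theorem pair_id_mem_representable (hU : U ∈ₙ C.C₀) :
    pair empty (ap C.i U) ∈ₙ (representable C U).F₀ :=
  (pair_mem_representable hU).2 ⟨C.i_fun.ap_mem hU, C.d₀_i U hU⟩

theorem IsNat.ap_id_mem_fibre (hU : U ∈ₙ C.C₀) (hF : IsDiagram C F) {α : V}
    (hα : IsNat C (representable C U) F α) :
    ap α (pair empty (ap C.i U)) ∈ₙ F.fibre U := by
  have h := pair_id_mem_representable hU
  refine hF.mem_fibre.2 ⟨hα.1.ap_mem h, ?_⟩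
  rw [hα.2.1 _ h, representable, ap_R_γ₀ (isFun_point hU) h, C.d₁_i U hU]

/-- Every element of `F(U)` is the value at the identity of a natural transformation. -/
theorem exists_isNat (hU : U ∈ₙ C.C₀) (hF : IsDiagram C F) {x : V} (hx : x ∈ₙ F.fibre U) :
    ∃ α, IsNat C (representable C U) F α ∧ ap α (pair empty (ap C.i U)) = x := by
  obtain ⟨hxF, hxU⟩ := hF.mem_fibre.1 hx
  have hu : IsFun (point U) one C.C₀ := isFun_point hU
  have hxf : ∀ f, pair x f ∈ₙ fibProd F.F₀ C.C₁ F.γ₀ C.d₀ ↔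
      pair empty f ∈ₙ (representable C U).F₀ := fun f => by
    rw [hF.pair_mem_iff, pair_mem_representable hU, hxU, eq_comm (a := U), and_iff_right hxF]
  -- `α` sends `⟨∅, f⟩` to `e⟨x, f⟩`, the value forced by `IsNat.ap_eq`. The domain of `e` already
  -- restricts `f` to arrows out of `U`.
  obtain ⟨α, hα⟩ := exists_set₂ (fun q x e => ∃ f w p z r, pair p w ∈ₙ e ∧ p = pair x f ∧
      z = empty ∧ r = pair z f ∧ q = pair r w) (4 ∷ 4 ∷ 5 ∷ 0)
    (.ex 4 (.ex 4 (.ex 4 (.ex 4 (.ex 4 (.and (.pair_mem 2 3 7 rfl rfl rfl)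
      (.and (.eq_pair 2 6 4 rfl rfl rfl) (.and (.eq_empty 1 rfl) (.and (.eq_pair 0 1 4 rfl rfl rfl)
        (.eq_pair 5 0 3 rfl rfl rfl)))))))))) x F.e
  have hαF : IsFun α (representable C U).F₀ F.F₀ := by
    refine ⟨fun q hq => ?_, fun p hp => ?_⟩
    · obtain ⟨f, w, _, _, _, h, rfl, rfl, rfl, rfl⟩ := (hα q).1 hq
      have h' := hF.e_fun.mem_of_pair_mem h
      exact ⟨_, _, (hxf f).1 h'.1, h'.2, rfl⟩
    · obtain ⟨f, rfl⟩ := exists_of_mem_representable hp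
      refine ⟨_, (hα _).2 ⟨f, _, _, _, _, hF.e_fun.pair_ap_mem ((hxf f).2 hp), rfl, rfl, rfl, rfl⟩,
        fun y hy => ?_⟩
      obtain ⟨f', w, _, _, _, h, rfl, rfl, rfl, e⟩ := (hα _).1 hy
      simp only [pair_inj, true_and] at e
      obtain ⟨rfl, rfl⟩ := e
      exact (hF.e_fun.ap_eq h).symm
  have hap : ∀ f, pair empty f ∈ₙ (representable C U).F₀ →
      ap α (pair empty f) = ap F.e (pair x f) := fun f hf =>
    hαF.ap_eq ((hα _).2 ⟨f, _, _, _, _, hF.e_fun.pair_ap_mem ((hxf f).2 hf), rfl, rfl, rfl, rfl⟩)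
  refine ⟨α, ⟨hαF, fun p hp => ?_, fun p g hp hg e => ?_⟩, ?_⟩
  · obtain ⟨f, rfl⟩ := exists_of_mem_representable hp
    obtain ⟨-, hf, e⟩ := hF.pair_mem_iff.1 ((hxf f).2 hp)
    rw [hap f hp, representable, ap_R_γ₀ hu hp, hF.γ₀_e x f hxF hf e]
  · obtain ⟨f, rfl⟩ := exists_of_mem_representable hp
    obtain ⟨-, hf, e'⟩ := hF.pair_mem_iff.1 ((hxf f).2 hp)
    rw [representable, ap_R_γ₀ hu hp] at e
    rw [hap f hp, hF.e_m x f g hxF hf hg e' e, representable, ap_R_e hu hp hg e,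
      hap _ (pair_comp_mem_R hu hp hg e)]
  · rw [hap _ (pair_id_mem_representable hU)]
    have h := hF.e_id x hxF
    rwa [hxU] at h

/-- The bijection from `Nat(C(U, -), F)` onto `N(1, F(U))` by evaluation at the identity. -/
theorem exists_isBij_natSet_funSet (hU : U ∈ₙ C.C₀) (hF : IsDiagram C F) :
    ∃ y : V, IsBij y (natSet C (representable C U) F) (funSet one (F.fibre U)) ∧
      ∀ α : V, IsNat C (representable C U) F α →
        ap (ap y α) empty = ap α (pair empty (ap C.i U)) := by
  have hR : IsDiagram C (representable C U) := isDiagram_R (isFun_point hU)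
  have hid := pair_id_mem_representable hU
  -- The value `x` of `α` at the identity has type 4, one below `α`; wrapping it as `{⟨∅, x⟩}` makes
  -- the pair with `α` stratified.
  obtain ⟨y, hy⟩ := exists_set₂ (fun q N a => ∃ α x z r p, α ∈ₙ N ∧ pair a x ∈ₙ α ∧ z = empty ∧
      r = pair z x ∧ p = sing r ∧ q = pair α p) (5 ∷ 6 ∷ 4 ∷ 0)
    (.ex 5 (.ex 4 (.ex 4 (.ex 4 (.ex 5 (.and (.mem 4 6 rfl) (.and (.pair_mem 7 3 4 rfl rfl rfl)
      (.and (.eq_empty 2 rfl) (.and (.eq_pair 1 2 3 rfl rfl rfl) (.and (.eq_sing 0 1 rfl rfl)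
        (.eq_pair 5 4 0 rfl rfl rfl)))))))))))
    (natSet C (representable C U) F) (pair empty (ap C.i U))
  have hq : ∀ q, q ∈ₙ y ↔ ∃ α, α ∈ₙ natSet C (representable C U) F ∧
      q = pair α (point (ap α (pair empty (ap C.i U)))) := fun q => by
    rw [hy]
    constructor
    · rintro ⟨α, x, _, _, _, hα, hx, rfl, rfl, rfl, rfl⟩
      exact ⟨α, hα, by rw [((mem_natSet hR hF).1 hα).1.ap_eq hx]; rfl⟩
    · rintro ⟨α, hα, rfl⟩
      exact ⟨α, _, _, _, _, hα, ((mem_natSet hR hF).1 hα).1.pair_ap_mem hid, rfl, rfl, rfl, rfl⟩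
  have hm : ∀ α, α ∈ₙ natSet C (representable C U) F →
      point (ap α (pair empty (ap C.i U))) ∈ₙ funSet one (F.fibre U) := fun α hα =>
    mem_funSet.2 (isFun_point (((mem_natSet hR hF).1 hα).ap_id_mem_fibre hU hF))
  refine ⟨y, IsFun.isBij (.of_graph hq hm) (fun α β hα hβ e => ?_) fun p hp => ?_, fun α hα => ?_⟩
  · rw [IsFun.ap_of_graph hq hm hα, IsFun.ap_of_graph hq hm hβ] at e
    replace e := congrArg (ap · empty) e
    simp only [ap_point] at e
    have hα := (mem_natSet hR hF).1 hα
    have hβ := (mem_natSet hR hF).1 hβ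
    refine hα.1.ext hβ.1 fun w hw => ?_
    obtain ⟨f, rfl⟩ := exists_of_mem_representable hw
    obtain ⟨hf, hfU⟩ := (pair_mem_representable hU).1 hw
    rw [hα.ap_eq hU hf hfU, hβ.ap_eq hU hf hfU, e]
  · have hp := mem_funSet.1 hp
    obtain ⟨α, hα, e⟩ := exists_isNat hU hF (hp.ap_mem (mem_one.2 rfl))
    have hα' := (mem_natSet hR hF).2 hα
    exact ⟨α, hα', by rw [IsFun.ap_of_graph hq hm hα', e, ← hp.eq_point]⟩
  · rw [IsFun.ap_of_graph hq hm ((mem_natSet hR hF).2 hα), ap_point]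

end Yoneda

end NF

theorem mainTheorem3 {V : Type*} [NF.Model V] (C : NF.InternalCategory V)
    (U : V) (hU : NF.Model.mem U C.C₀) (F : NF.DiagramData V) (hF : NF.IsDiagram C F) :
    -- `C(U, -)` is an internal covariant presheaf on `C`
    NF.IsDiagram C (NF.representable C U) ∧
    -- the natural transformations `C(U, -) → F` form a set of the model, and so do the
    -- arrows `1 → F(U)`
    (∀ α : V, NF.Model.mem α (NF.natSet C (NF.representable C U) F) ↔
      NF.IsNat C (NF.representable C U) F α) ∧
    (∀ p : V, NF.Model.mem p (NF.funSet NF.one (F.fibre U)) ↔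
      NF.IsFun p NF.one (F.fibre U)) ∧
    -- `Nat(C(U, -), F) ≅ N(1, F(U))`, by evaluation at the identity of `U`
    (∃ y : V, NF.IsBij y (NF.natSet C (NF.representable C U) F)
        (NF.funSet NF.one (F.fibre U)) ∧
      ∀ α : V, NF.IsNat C (NF.representable C U) F α →
        NF.ap (NF.ap y α) NF.empty = NF.ap α (NF.pair NF.empty (NF.ap C.i U))) ∧
    -- `N(1, F(U)) ≅ T(F(U))`
    (∃ t : V, NF.IsBij t (NF.funSet NF.one (F.fibre U)) (NF.T (F.fibre U)) ∧
      ∀ p : V, NF.IsFun p NF.one (F.fibre U) →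
        NF.ap t p = NF.sing (NF.ap p NF.empty)) ∧
    -- the set of natural transformations has the same size as a set of singletons
    (∃ S : V, (∀ z : V, NF.Model.mem z S → ∃ x : V, z = NF.sing x) ∧
      NF.SameSize (NF.natSet C (NF.representable C U) F) S) ∧
    -- if `F(U)` is cantorian, the classical form holds
    (NF.Cantorian (F.fibre U) →
      NF.SameSize (NF.natSet C (NF.representable C U) F) (F.fibre U)) := by
  have hR : NF.IsDiagram C (NF.representable C U) := NF.isDiagram_R (NF.isFun_point hU)
  obtain ⟨y, hy, hy'⟩ := NF.exists_isBij_natSet_funSet hU hF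
  obtain ⟨t, ht, ht'⟩ := NF.exists_isBij_funSet_T (F.fibre U)
  have hT : NF.SameSize (NF.natSet C (NF.representable C U) F) (NF.T (F.fibre U)) :=
    NF.SameSize.trans ⟨y, hy⟩ ⟨t, ht⟩
  refine ⟨hR, fun _ => NF.mem_natSet hR hF, fun _ => NF.mem_funSet, ⟨y, hy, hy'⟩, ⟨t, ht, ht'⟩,
    ⟨_, fun z hz => ?_, hT⟩, fun hc => hT.trans hc.symm⟩
  obtain ⟨x, _, e⟩ := (NF.mem_T _ _).1 hz
  exact ⟨x, e⟩
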